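/- **Setting.** Identify the natural numbers with the finite binary words by $0\mapsto\epsilon$, $1\mapsto 0$, $2\mapsto 1$, $3\mapsto 00,\dots$, write $|x|$ for the length of the word $x$, and let $\langle x,y\rangle = 1^{|x|}0xy$. Machines are deterministic multitape Turing machines with one input/output tape and a single halting state. Write $T(w)=u$ if $T$, started on input $w$, halts with output $u$. A Turing machine is *reversible* if every instantaneous description has at most one predecessor and the start state is never entered; for a reversible machine $R$, $R(w)=u$ means in addition that at the end $u$ is the only thing left on the tapes. Let $U$ be any universal Turing machine, i.e. for every Turing machine $T$ there is a word $i$ such that $U(\langle\langle i,p\rangle,y\rangle)=T(\langle p,y\rangle)$ for all $p,y$ (both sides being possibly undefined). Put $$C(x|y)=\min\{|p| : U(\langle p,y\rangle)=x\},\qquad C(x)=C(x|\epsilon),$$ and, for a time bound $t:\mathbb N\to\mathbb N$, $$C^t(x)=\min\{|p| : U(\langle p,\epsilon\rangle)=x \text{ in at most } t(|x|) \text{ steps}\}$$ ($\infty$ if there is no such $p$). For a reversible Turing machine $R$ put $E_R(x,y)=\min\{|p|+|q| : R(\langle x,p\rangle)=\langle y,q\rangle\}$. Let $UR$ be any reversible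 Turing machine whose cost function is universal, i.e. for every reversible Turing machine $R$ there is a constant $c_R$ with $E_{UR}(x,y)\le E_R(x,y)+c_R$ for all $x,y$, and put $E(x,y)=E_{UR}(x,y)$, the irreversibility cost of computing $y$ from $x$. **Corollary.** Up to an additive constant which does not depend on $x$, the irreversibility cost of erasing $x$ satisfies $$E(x,\epsilon)\ \ge\ \lim_{t\to\infty}C^t(x)=C(x),$$ where $C(x)$ is finite, and the limit is meant for each fixed $x$, along any sequence of time bounds $t_n$ with $t_n(|x|)\to\infty$; the equality with the limit is exact. Moreover $E(x,\epsilon)=C(x)$ up to an additional logarithmic term: there is a constant $c$, independent of $x$, with $$C(x)-c\ \le\ E(x,\epsilon)\ \le\ C(x)+c\,\bigl(C(C(x)\,|\,x)+1\bigr)\quad\text{and}\quad E(x,\epsilon)\ \le\ C(x)+c\,\bigl(\lfloor\log_2 \max(C(x),1)\rfloor+1\bigr)$$ for all words $x$. -/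

import Mathlib

open Filter Topology

namespace RevComp

/-- Tape symbols: the blank, the two bits, and finitely many auxiliary storage symbols. -/
inductive Sym (A : Type) : Type
  | blank : Sym A
  | bit (b : Bool) : Sym A
  | aux (a : A) : Sym A

instance (A : Type) : Inhabited (Sym A) := ⟨Sym.blank⟩

/-- A deterministic multitape Turing machine with tapes `0, …, k`, where tape `0` is the
input/output tape. A control state is an element of `Option Q`, and `none` is the unique halting
state. In state `q`, when the scanned symbols are `s`, the value `δ q s = some (q', a)` means:
enter state `q'`, and on each tape `i` write the symbol `(a i).1` and then move the head as
`(a i).2` says (`none` is no move). If `δ q s = none`, the machine is stuck (no output). -/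
structure TM : Type 1 where
  Q : Type
  finQ : Finite Q
  A : Type
  finA : Finite A
  k : ℕ
  start : Q
  δ : Q → (Fin (k + 1) → Sym A) →
    Option (Option Q × (Fin (k + 1) → Sym A × Option Turing.Dir))

/-- Instantaneous descriptions: control state and all tapes, with head positions. -/
@[ext] structure Cfg (M : TM) : Type where
  state : Option M.Q
  tape : Fin (M.k + 1) → Turing.Tape (Sym M.A)

/-- Write a symbol on the scanned square and then perform a move. -/
def act {A : Type} (a : Sym A × Option Turing.Dir) (T : Turing.Tape (Sym A)) :
    Turing.Tape (Sym A) :=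
  match a.2 with
  | none => T.write a.1
  | some d => (T.write a.1).move d

/-- The tape that holds the binary word `w` and is blank elsewhere, with the head on the first
symbol of `w`. -/
def wordTape (A : Type) (w : List Bool) : Turing.Tape (Sym A) :=
  Turing.Tape.mk₁ (w.map Sym.bit)

namespace TM

variable (M : TM)

/-- One computation step. -/
def step (c : Cfg M) : Option (Cfg M) :=
  match c.state with
  | none => none
  | some q =>
    match M.δ q (fun i => (c.tape i).head) with
    | none => none
    | some (q', a) => some ⟨q', fun i => act (a i) (c.tape i)⟩

/-- The description reached after exactly `n` steps, if the machine makes that many. -/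
def run : ℕ → Cfg M → Option (Cfg M)
  | 0, c => some c
  | n + 1, c => (M.step c).bind (run n)

/-- A description in which tape `0` holds the word `w` and all the other tapes are blank. -/
def cleanCfg (q : Option M.Q) (w : List Bool) : Cfg M :=
  ⟨q, fun i => if i = 0 then wordTape M.A w else wordTape M.A []⟩

/-- The initial description on input `w`. -/
def init (w : List Bool) : Cfg M := M.cleanCfg (some M.start) w

/-- `M(w) = u` in at most `n` steps: `M` halts with `u` on the output tape; whatever is left on
the other tapes is ignored. -/
def OutputsWithin (w u : List Bool) (n : ℕ) : Prop :=
  ∃ m ≤ n, ∃ c, M.run m (M.init w) = some c ∧ c.state = none ∧ c.tape 0 = wordTape M.A u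

/-- `M(w) = u`. -/
def Outputs (w u : List Bool) : Prop := ∃ n, M.OutputsWithin w u n

/-- `M(w) = u` with nothing but `u` left in the memory: `M` halts with `u` on the output tape and
all the other tapes blank. -/
def OutputsClean (w u : List Bool) : Prop := ∃ m, M.run m (M.init w) = some (M.cleanCfg none u)

/-- `M` is a reversible Turing machine: each instantaneous description has at most one
predecessor, and the start state is never entered (just as the halting state is never left). -/
def Reversible : Prop :=
  (∀ c₁ c₂ c, M.step c₁ = some c → M.step c₂ = some c → c₁ = c₂) ∧
    ∀ c₁ c, M.step c₁ = some c → c.state ≠ some M.start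

end TM

/-- The pairing `⟨x, y⟩ = 1^{|x|} 0 x y` of binary words. -/
def pair (x y : List Bool) : List Bool := List.replicate x.length true ++ false :: (x ++ y)

/-- The identification `0 ↦ ε, 1 ↦ 0, 2 ↦ 1, 3 ↦ 00, 4 ↦ 01, …` of `ℕ` with the binary words:
the binary expansion of `n + 1` without its leading digit `1`. -/
def word (n : ℕ) : List Bool := (Nat.bits (n + 1)).dropLast.reverse

/-- `U` is a universal Turing machine: for each Turing machine `T` there is an index `i` with
`U(⟨⟨i, p⟩, y⟩) = T(⟨p, y⟩)` for all `p` and `y` (also as to being undefined). -/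
def IsUniversal (U : TM) : Prop :=
  ∀ T : TM, ∃ i : List Bool, ∀ p y u : List Bool,
    U.Outputs (pair (pair i p) y) u ↔ T.Outputs (pair p y) u

/-- The conditional Kolmogorov complexity `C(x|y)` with respect to `U`
(`⊤` if no program computes `x` from `y`). -/
noncomputable def condC (U : TM) (x y : List Bool) : ℕ∞ :=
  ⨅ (p : List Bool) (_ : U.Outputs (pair p y) x), (p.length : ℕ∞)

/-- The Kolmogorov complexity `C(x) = C(x|ε)`. -/
noncomputable def C (U : TM) (x : List Bool) : ℕ∞ := condC U x []

/-- The `t`-time-limited conditional Kolmogorov complexity `C^t(x|y)` with respect to `U`. -/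
noncomputable def condCt (U : TM) (t : ℕ → ℕ) (x y : List Bool) : ℕ∞ :=
  ⨅ (p : List Bool) (_ : U.OutputsWithin (pair p y) x (t x.length)), (p.length : ℕ∞)

/-- The `t`-time-limited Kolmogorov complexity `C^t(x) = C^t(x|ε)`. -/
noncomputable def Ct (U : TM) (t : ℕ → ℕ) (x : List Bool) : ℕ∞ := condCt U t x []

/-- The irreversibility cost `E_R(x, y)`: the least `|p| + |q|` with `R(⟨x, p⟩) = ⟨y, q⟩`. -/
noncomputable def E (R : TM) (x y : List Bool) : ℕ∞ :=
  ⨅ (p : List Bool) (q : List Bool) (_ : R.OutputsClean (pair x p) (pair y q)),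
    ((p.length + q.length : ℕ) : ℕ∞)

/-- `UR` is a reversible Turing machine and `E_UR` is a universal irreversibility cost function:
it is minimal, up to an additive constant, among those of all reversible Turing machines. -/
def IsUniversalReversible (UR : TM) : Prop :=
  UR.Reversible ∧
    ∀ R : TM, R.Reversible → ∃ c : ℕ, ∀ x y : List Bool, E UR x y ≤ E R x y + c

end RevComp

/-!
By Bennett's construction, a partial computable injection with a partial computable inverse is
computed by a reversible machine: compute while recording a history, copy the output, undo the
computation, and then erase the input by running the same procedure for the inverse backwards.

A reversible machine computes an injection, so if `R(⟨x, p⟩) = ⟨ε, q⟩` then `x` is recovered from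
`q`, which gives `C(x) ≤ E(x, ε) + c`. Conversely, if `p` is a shortest program of `C(x)` given
`x`, then a shortest program `z` of `x` can be found from `x` and `p` by dovetailed search, and `x`
is recovered by running `z`. The map `⟨x, p⟩ ↦ ⟨ε, ⟨p, z⟩⟩` is therefore reversibly computable, and
its cost is `C(x)` plus a multiple of `|p| + 1`.
-/

namespace RevComp

open Function Relation

section Instructions

/-- Move the head as prescribed, where `none` stands for no move. -/
def shift {Γ : Type} [Inhabited Γ] : Option Turing.Dir → Turing.Tape Γ → Turing.Tape Γ
  | none, T => T
  | some d, T => T.move d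

/-- The opposite of a head movement. -/
def flipDir : Option Turing.Dir → Option Turing.Dir
  | none => none
  | some .left => some .right
  | some .right => some .left

theorem flipDir_flipDir (d : Option Turing.Dir) : flipDir (flipDir d) = d := by
  rcases d with _ | _ | _ <;> rfl

theorem shift_flipDir_shift {Γ : Type} [Inhabited Γ] (d : Option Turing.Dir)
    (T : Turing.Tape Γ) : shift (flipDir d) (shift d T) = T := by
  rcases d with _ | _ | _ <;> simp [shift, flipDir]

/-- The instructions of a multitape machine in quadruple form: either replace the scanned
symbols `v` by `v'`, or move the heads. Keeping the two apart makes instructions invertible. -/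
inductive Instr (ι Γ : Type) : Type
  | write (v v' : ι → Γ) : Instr ι Γ
  | move (d : ι → Option Turing.Dir) : Instr ι Γ

namespace Instr

variable {ι Γ : Type}

/-- The inverse instruction. -/
def inv : Instr ι Γ → Instr ι Γ
  | write v v' => write v' v
  | move d => move fun i => flipDir (d i)

/-- Two rewriting instructions that are never applicable to the same tapes. -/
def Clash : Instr ι Γ → Instr ι Γ → Prop
  | write v _, write w _ => v ≠ w
  | _, _ => False

theorem inv_inv (i : Instr ι Γ) : i.inv.inv = i := by
  cases i <;> simp [inv, flipDir_flipDir]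

theorem inv_injective : Injective (inv : Instr ι Γ → Instr ι Γ) :=
  LeftInverse.injective inv_inv

theorem write_clash_or_eq {v v' w w' : ι → Γ} {P : Prop} (h : v = w → v' = w' ∧ P) :
    (write v v').Clash (write w w') ∨ (write v v' = write w w' ∧ P) :=
  or_iff_not_imp_left.2 fun hvw =>
    have e := not_not.1 hvw
    (h e).imp_left fun e' => by rw [e, e']

theorem inv_write_clash_or_eq {v v' w w' : ι → Γ} {P : Prop} (h : v' = w' → v = w ∧ P) :
    (write v v').inv.Clash (write w w').inv ∨ (write v v' = write w w' ∧ P) :=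
  (write_clash_or_eq h).imp_right fun e => ⟨inv_injective e.1, e.2⟩

variable [Inhabited Γ] {i j : Instr ι Γ} {τ τ' τ₁ τ₂ : ι → Turing.Tape Γ}

/-- The instruction transforms the tapes `τ` into the tapes `τ'`. -/
def Rel : Instr ι Γ → (ι → Turing.Tape Γ) → (ι → Turing.Tape Γ) → Prop
  | write v v', τ, τ' => (∀ i, (τ i).head = v i) ∧ τ' = fun i => (τ i).write (v' i)
  | move d, τ, τ' => τ' = fun i => shift (d i) (τ i)

theorem Rel.symm (h : i.Rel τ τ') : i.inv.Rel τ' τ := by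
  cases i with
  | write v v' =>
    obtain ⟨h, rfl⟩ := h
    exact ⟨fun i => rfl, funext fun i => by simp [Turing.Tape.write, ← h i]⟩
  | move d =>
    obtain rfl := h
    exact funext fun i => (shift_flipDir_shift (d i) (τ i)).symm

theorem Rel.right_unique (h₁ : i.Rel τ τ₁) (h₂ : i.Rel τ τ₂) : τ₁ = τ₂ := by
  cases i with
  | write v v' => exact h₁.2.trans h₂.2.symm
  | move d => exact Eq.trans h₁ (Eq.symm h₂)

theorem Rel.not_clash (h₁ : i.Rel τ τ₁) (h₂ : j.Rel τ τ₂) : ¬ i.Clash j := by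
  cases i <;> cases j <;> simp only [Clash, not_false_eq_true, not_not, ne_eq]
  exact funext fun i => (h₁.1 i).symm.trans (h₂.1 i)

end Instr

end Instructions

theorem eq_of_update_eq_update {ι Γ : Type} [DecidableEq ι] {i : ι} {a b : Γ}
    {v w : ι → Γ} (hi : v i = w i) (h : update v i a = update w i b) : v = w := by
  rw [← update_eq_self i v, ← update_eq_self i w, hi, ← update_idem a _ v, h, update_idem]

/-- A reversible machine in quadruple form: a finite transition system labelled by instructions
which is deterministic in both directions, with a source `start` and a sink `halt`. -/
structure RevMachine (ι Γ : Type) : Type 1 where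
  State : Type
  finite_state : Finite State
  Trans : State → Instr ι Γ → State → Prop
  start : State
  halt : State
  det : ∀ {q i a j b}, Trans q i a → Trans q j b → i.Clash j ∨ (i = j ∧ a = b)
  codet : ∀ {q i a j b}, Trans a i q → Trans b j q → i.inv.Clash j.inv ∨ (i = j ∧ a = b)
  not_trans_start : ∀ {q i}, ¬ Trans q i start
  not_halt_trans : ∀ {q i}, ¬ Trans halt i q

namespace RevMachine

variable {ι Γ : Type}

section Semantics

variable [Inhabited Γ] {M : RevMachine ι Γ} {c c' c₁ c₂ : M.State × (ι → Turing.Tape Γ)}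
  {τ τ' : ι → Turing.Tape Γ}

/-- One step of a machine in quadruple form. -/
def Step (M : RevMachine ι Γ) (c d : M.State × (ι → Turing.Tape Γ)) : Prop :=
  ∃ i, M.Trans c.1 i d.1 ∧ i.Rel c.2 d.2

/-- The machine transforms the tapes `τ` into the tapes `τ'`. -/
def Computes (M : RevMachine ι Γ) (τ τ' : ι → Turing.Tape Γ) : Prop :=
  ReflTransGen M.Step (M.start, τ) (M.halt, τ')

theorem Step.right_unique (h₁ : M.Step c c₁) (h₂ : M.Step c c₂) : c₁ = c₂ := by
  obtain ⟨i, hi, ri⟩ := h₁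
  obtain ⟨j, hj, rj⟩ := h₂
  rcases M.det hi hj with h | ⟨rfl, h⟩
  · exact absurd h (ri.not_clash rj)
  · exact Prod.ext h (ri.right_unique rj)

theorem Step.left_unique (h₁ : M.Step c₁ c) (h₂ : M.Step c₂ c) : c₁ = c₂ := by
  obtain ⟨i, hi, ri⟩ := h₁
  obtain ⟨j, hj, rj⟩ := h₂
  rcases M.codet hi hj with h | ⟨rfl, h⟩
  · exact absurd h (ri.symm.not_clash rj.symm)
  · exact Prod.ext h (ri.symm.right_unique rj.symm)

theorem Step.write_self {q q' : M.State}
    (h : M.Trans q (.write (fun i => (τ i).head) fun i => (τ i).head) q') :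
    M.Step (q, τ) (q', τ) :=
  ⟨_, h, fun _ => rfl, funext fun i => ((τ i).write_self).symm⟩

theorem Step.write_update [DecidableEq ι] {q q' : M.State} {i : ι} {b : Γ}
    (h : M.Trans q (.write (fun j => (τ j).head) (update (fun j => (τ j).head) i b)) q') :
    M.Step (q, τ) (q', update τ i ((τ i).write b)) := by
  refine ⟨_, h, fun _ => rfl, funext fun j => ?_⟩
  obtain rfl | hj := eq_or_ne j i
  · simp
  · simp [hj]

theorem Step.move_update [DecidableEq ι] {q q' : M.State} {i : ι} {d : Option Turing.Dir}
    (h : M.Trans q (.move (update (fun _ => none) i d)) q') :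
    M.Step (q, τ) (q', update τ i (shift d (τ i))) := by
  refine ⟨_, h, funext fun j => ?_⟩
  obtain rfl | hj := eq_or_ne j i
  · simp
  · simp [hj, shift]

end Semantics

section Inverse

/-- The inverse machine. -/
def inv (M : RevMachine ι Γ) : RevMachine ι Γ where
  State := M.State
  finite_state := M.finite_state
  Trans a i b := M.Trans b i.inv a
  start := M.halt
  halt := M.start
  det h₁ h₂ := by
    have := M.codet h₁ h₂
    rwa [Instr.inv_inv, Instr.inv_inv, Instr.inv_injective.eq_iff] at this
  codet h₁ h₂ := by
    have := M.det h₁ h₂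
    rwa [Instr.inv_injective.eq_iff] at this
  not_trans_start := M.not_halt_trans
  not_halt_trans := M.not_trans_start

theorem Computes.inv [Inhabited Γ] {M : RevMachine ι Γ} {τ τ' : ι → Turing.Tape Γ}
    (h : M.Computes τ τ') : M.inv.Computes τ' τ := by
  refine ReflTransGen.mono (r := Function.swap M.Step) ?_ _ _ (ReflTransGen.swap _ _ h)
  rintro a b ⟨i, hi, r⟩
  exact ⟨i.inv, by simpa [RevMachine.inv, Instr.inv_inv] using hi, r.symm⟩

end Inverse

section SequentialComposition

variable (M N : RevMachine ι Γ)

/-- The transitions of a sequential composition; `link` goes from the end of the first machine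
to the start of the second one. -/
inductive SeqTrans : M.State ⊕ N.State → Instr ι Γ → M.State ⊕ N.State → Prop
  | left {a i b} : M.Trans a i b → SeqTrans (.inl a) i (.inl b)
  | right {a i b} : N.Trans a i b → SeqTrans (.inr a) i (.inr b)
  | link : SeqTrans (.inl M.halt) (.move fun _ => none) (.inr N.start)

/-- Sequential composition. -/
def seq : RevMachine ι Γ where
  State := M.State ⊕ N.State
  finite_state := by
    have := M.finite_state
    have := N.finite_state
    infer_instance
  Trans := SeqTrans M N
  start := .inl M.start
  halt := .inr N.halt
  det := by
    rintro q i a j b (⟨h⟩ | ⟨h⟩ | _) h'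
    · cases h' with
      | left h' => simpa using M.det h h'
      | link => exact absurd h M.not_halt_trans
    · cases h' with
      | right h' => simpa using N.det h h'
    · cases h' with
      | left h' => exact absurd h' M.not_halt_trans
      | link => simp
  codet := by
    rintro q i a j b (⟨h⟩ | ⟨h⟩ | _) h'
    · cases h' with
      | left h' => simpa using M.codet h h'
    · cases h' with
      | right h' => simpa using N.codet h h'
      | link => exact absurd h N.not_trans_start
    · cases h' with
      | right h' => exact absurd h' N.not_trans_start
      | link => simp
  not_trans_start := by
    rintro q i ⟨h⟩
    exact M.not_trans_start ‹_›
  not_halt_trans := by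
    rintro q i (_ | ⟨h⟩ | _)
    exact N.not_halt_trans ‹_›

variable {M N} in
theorem Computes.seq [Inhabited Γ] {τ₁ τ₂ τ₃ : ι → Turing.Tape Γ} (h₁ : M.Computes τ₁ τ₂)
    (h₂ : N.Computes τ₂ τ₃) : (M.seq N).Computes τ₁ τ₃ := by
  have left : ReflTransGen (M.seq N).Step (.inl M.start, τ₁) (.inl M.halt, τ₂) :=
    ReflTransGen.lift (r := M.Step) (fun c => (Sum.inl c.1, c.2))
      (fun _ _ ⟨i, hi, r⟩ => ⟨i, SeqTrans.left hi, r⟩) _ _ h₁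
  have right : ReflTransGen (M.seq N).Step (.inr N.start, τ₂) (.inr N.halt, τ₃) :=
    ReflTransGen.lift (r := N.Step) (fun c => (Sum.inr c.1, c.2))
      (fun _ _ ⟨i, hi, r⟩ => ⟨i, SeqTrans.right hi, r⟩) _ _ h₂
  have link : (M.seq N).Step (.inl M.halt, τ₂) (.inr N.start, τ₂) :=
    ⟨_, SeqTrans.link, rfl⟩
  exact (left.tail link).trans right

end SequentialComposition

section OneStep

/-- The machine that performs one of the instructions of a set of pairwise clashing instructions
with pairwise clashing inverses. -/
def oneStep (I : Set (Instr ι Γ)) (det : I.Pairwise Instr.Clash)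
    (codet : I.Pairwise fun i j => i.inv.Clash j.inv) : RevMachine ι Γ where
  State := Bool
  finite_state := inferInstance
  Trans a i b := a = false ∧ i ∈ I ∧ b = true
  start := false
  halt := true
  det := by
    rintro q i a j b ⟨-, hi, rfl⟩ ⟨-, hj, rfl⟩
    exact or_iff_not_imp_right.2 fun h => det hi hj fun e => h ⟨e, rfl⟩
  codet := by
    rintro q i a j b ⟨rfl, hi, -⟩ ⟨rfl, hj, -⟩
    exact or_iff_not_imp_right.2 fun h => codet hi hj fun e => h ⟨e, rfl⟩
  not_trans_start := by simp
  not_halt_trans := by simp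

/-- The machine that moves the heads once. -/
def mover (d : ι → Option Turing.Dir) : RevMachine ι Γ :=
  oneStep {.move d} (Set.pairwise_singleton _ _) (Set.pairwise_singleton _ _)

theorem mover_computes [Inhabited Γ] (d : ι → Option Turing.Dir) (τ : ι → Turing.Tape Γ) :
    (mover d).Computes τ fun i => shift (d i) (τ i) :=
  .single ⟨_, ⟨rfl, rfl, rfl⟩, rfl⟩

variable [DecidableEq ι]

/-- The machine that replaces the scanned symbol `a` of tape `i` by `b`. -/
def rewriter (i : ι) (a b : Γ) : RevMachine ι Γ :=
  oneStep {s | ∃ v : ι → Γ, v i = a ∧ s = .write v (update v i b)}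
    (by
      rintro _ ⟨v, -, rfl⟩ _ ⟨w, -, rfl⟩ h
      exact fun e => h (by rw [e]))
    (by
      rintro _ ⟨v, hv, rfl⟩ _ ⟨w, hw, rfl⟩ h e
      exact h (by rw [eq_of_update_eq_update (hv.trans hw.symm) e]))

theorem rewriter_computes [Inhabited Γ] (i : ι) (b : Γ) (τ : ι → Turing.Tape Γ) :
    (rewriter i (τ i).head b).Computes τ (update τ i ((τ i).write b)) :=
  .single (Step.write_update ⟨rfl, ⟨_, rfl, rfl⟩, rfl⟩)

end OneStep

section Execution

variable {A : Type} {k : ℕ}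

/-- The transition function of the Turing machine that executes `M`. It is defined by choice, but
by `M.det` at most one transition of `M` applies to given scanned symbols. -/
noncomputable def delta (M : RevMachine (Fin (k + 1)) (Sym A)) (q : M.State)
    (v : Fin (k + 1) → Sym A) :
    Option (Option M.State × (Fin (k + 1) → Sym A × Option Turing.Dir)) :=
  open Classical in
  if q = M.halt then some (none, fun i => (v i, none))
  else if h : ∃ p : (Fin (k + 1) → Option Turing.Dir) × M.State, M.Trans q (.move p.1) p.2 then
    some (some h.choose.2, fun i => (v i, h.choose.1 i))
  else if h : ∃ p : (Fin (k + 1) → Sym A) × M.State, M.Trans q (.write v p.1) p.2 then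
    some (some h.choose.2, fun i => (h.choose.1 i, none))
  else none

/-- The Turing machine that executes a machine in quadruple form. -/
noncomputable abbrev toTM [Finite A] (M : RevMachine (Fin (k + 1)) (Sym A)) : TM where
  Q := M.State
  finQ := M.finite_state
  A := A
  finA := inferInstance
  k := k
  start := M.start
  δ := M.delta

theorem act_head (T : Turing.Tape (Sym A)) (d : Option Turing.Dir) :
    act (T.head, d) T = shift d T := by
  rcases d with _ | d <;> simp [act, shift]

variable (M : RevMachine (Fin (k + 1)) (Sym A)) {q q' : M.State}
  {τ τ' : Fin (k + 1) → Turing.Tape (Sym A)}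

theorem delta_halt (v : Fin (k + 1) → Sym A) :
    M.delta M.halt v = some (none, fun i => (v i, none)) := by
  simp [delta]

theorem exists_step_of_delta (hq : q ≠ M.halt) {p}
    (h : M.delta q (fun i => (τ i).head) = some p) :
    ∃ q', p.1 = some q' ∧ M.Step (q, τ) (q', fun i => act (p.2 i) (τ i)) := by
  rw [delta, if_neg hq] at h
  split_ifs at h with h₁ h₂
  · obtain rfl := Option.some_injective _ h
    exact ⟨_, rfl, _, h₁.choose_spec, funext fun i => act_head _ _⟩
  · obtain rfl := Option.some_injective _ h
    exact ⟨_, rfl, _, h₂.choose_spec, fun i => rfl, rfl⟩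

theorem exists_delta_of_step (h : M.Step (q, τ) (q', τ')) :
    ∃ p, M.delta q (fun i => (τ i).head) = some p := by
  obtain ⟨i, hi, r⟩ := h
  rw [delta]
  split_ifs with h₀ h₁ h₂
  · exact ⟨_, rfl⟩
  · exact ⟨_, rfl⟩
  · exact ⟨_, rfl⟩
  · cases i with
    | move d => exact absurd ⟨(d, q'), hi⟩ h₁
    | write v v' =>
      obtain rfl : (fun i => (τ i).head) = v := funext r.1
      exact absurd ⟨(v', q'), hi⟩ h₂

variable [Finite A]

theorem toTM_step_halt (τ : Fin (k + 1) → Turing.Tape (Sym A)) :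
    M.toTM.step ⟨some M.halt, τ⟩ = some ⟨none, τ⟩ := by
  simp [TM.step, delta_halt, act]

theorem toTM_step_eq_some {c c' : Cfg M.toTM} (h : M.toTM.step c = some c') :
    (c.state = some M.halt ∧ c' = ⟨none, c.tape⟩) ∨
      ∃ q q', c.state = some q ∧ c'.state = some q' ∧ M.Step (q, c.tape) (q', c'.tape) := by
  obtain ⟨_ | q, τ⟩ := c
  · simp [TM.step] at h
  by_cases hq : q = M.halt
  · subst hq
    exact .inl ⟨rfl, Option.some_injective _ (h.symm.trans (M.toTM_step_halt τ))⟩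
  right
  simp only [TM.step] at h
  split at h
  · simp at h
  rename_i q' a heq
  obtain rfl := Option.some_injective _ h
  obtain ⟨p, hp, hs⟩ := M.exists_step_of_delta hq heq
  exact ⟨q, p, rfl, hp, hs⟩

theorem toTM_step_of_step (h : M.Step (q, τ) (q', τ')) :
    M.toTM.step ⟨some q, τ⟩ = some ⟨some q', τ'⟩ := by
  have hq : q ≠ M.halt := by
    rintro rfl
    exact M.not_halt_trans h.choose_spec.1
  obtain ⟨p, hp⟩ := M.exists_delta_of_step h
  obtain ⟨q₁, h₁, hs⟩ := M.exists_step_of_delta hq hp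
  obtain ⟨rfl, rfl⟩ := Prod.mk.inj (hs.right_unique h)
  simp only [TM.step, hp, h₁]

theorem toTM_reversible : M.toTM.Reversible := by
  refine ⟨fun c₁ c₂ c h₁ h₂ => ?_, fun c₁ c h hs => ?_⟩
  · rcases M.toTM_step_eq_some h₁ with ⟨e₁, rfl⟩ | ⟨a, b, ha, hb, step₁⟩ <;>
      rcases M.toTM_step_eq_some h₂ with ⟨e₂, r₂⟩ | ⟨a', b', ha', hb', step₂⟩
    · exact Cfg.ext (e₁.trans e₂.symm) (Cfg.mk.inj r₂).2
    · cases hb'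
    · cases r₂ ▸ hb
    · obtain rfl : b = b' := Option.some_injective _ (hb.symm.trans hb')
      obtain ⟨rfl, e⟩ := Prod.mk.inj (step₁.left_unique step₂)
      exact Cfg.ext (ha.trans ha'.symm) e
  · rcases M.toTM_step_eq_some h with ⟨-, rfl⟩ | ⟨a, b, -, hb, i, hi, -⟩
    · cases hs
    · obtain rfl : b = M.start := Option.some_injective _ (hb.symm.trans hs)
      exact M.not_trans_start hi

theorem exists_run_of_reflTransGen (h : ReflTransGen M.Step (q, τ) (M.halt, τ')) :
    ∃ m, M.toTM.run m ⟨some q, τ⟩ = some ⟨none, τ'⟩ := by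
  generalize hc : (q, τ) = c at h
  induction h using ReflTransGen.head_induction_on generalizing q τ with
  | refl =>
    cases hc
    exact ⟨1, by simp only [TM.run]; rw [M.toTM_step_halt]; rfl⟩
  | head h _ ih =>
    subst hc
    obtain ⟨m, hm⟩ := ih rfl
    exact ⟨m + 1, by simp only [TM.run, M.toTM_step_of_step h]; exact hm⟩

end Execution

end RevMachine

section Copying

variable {ι Γ : Type} [DecidableEq ι]

/-- The tapes `τ` with the contents of the tapes `i` and `j` replaced by `T` and `T'`. -/
def setPair {α : Type} (τ : ι → α) (i j : ι) (T₁ T₂ : α) : ι → α :=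
  update (update τ i T₁) j T₂

/-- The head movement that moves the heads of the tapes `i` and `j` in direction `d`. -/
def bothDir (i j : ι) (d : Turing.Dir) (l : ι) : Option Turing.Dir :=
  if l = i ∨ l = j then some d else none

section SetPair

variable {α : Type} {i j l : ι} (τ : ι → α) (T T' : α)

theorem setPair_left (h : i ≠ j) : setPair τ i j T T' i = T := by simp [setPair, h]

theorem setPair_right : setPair τ i j T T' j = T' := by simp [setPair]

theorem setPair_of_ne (hi : l ≠ i) (hj : l ≠ j) : setPair τ i j T T' l = τ l := by
  simp [setPair, hi, hj]

theorem setPair_self : setPair τ i j (τ i) (τ j) = τ := by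
  simp [setPair]

theorem setPair_self_left : setPair τ i j (τ i) T' = update τ j T' := by
  simp [setPair]

theorem update_setPair_left (h : i ≠ j) (T₁ : α) :
    update (setPair τ i j T T') i T₁ = setPair τ i j T₁ T' := by
  rw [setPair, update_comm h.symm, update_idem, setPair]

theorem update_setPair_right (T₁ : α) :
    update (setPair τ i j T T') j T₁ = setPair τ i j T T₁ := by
  rw [setPair, update_idem, setPair]

end SetPair

theorem shift_bothDir [Inhabited Γ] {i j : ι} (h : i ≠ j) (τ : ι → Turing.Tape Γ)
    (T T' : Turing.Tape Γ) (d : Turing.Dir) :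
    (fun l => shift (bothDir i j d l) (setPair τ i j T T' l)) =
      setPair τ i j (T.move d) (T'.move d) := by
  ext1 l
  obtain rfl | hj := eq_or_ne l j
  · simp only [setPair_right, bothDir, or_true, if_true, shift]
  obtain rfl | hi := eq_or_ne l i
  · simp only [setPair_left _ _ _ h, bothDir, true_or, if_true, shift]
  · simp only [setPair_of_ne _ _ _ hi hj, bothDir, hi, hj, or_self, if_false, shift]

theorem eq_of_update_eq_update_apply {i j : ι} (hij : i ≠ j) {f old : Γ → Γ} {v w : ι → Γ}
    (hv : v j = old (f (v i))) (hw : w j = old (f (w i)))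
    (h : update v j (f (v i)) = update w j (f (w i))) : v = w := by
  have hi : v i = w i := by simpa [hij] using congrFun h i
  exact eq_of_update_eq_update (by rw [hv, hw, hi]) h

end Copying

section MapTape

variable {Γ Γ' : Type} [Inhabited Γ] [Inhabited Γ'] (f : Turing.PointedMap Γ Γ')

theorem right₀_map (T : Turing.Tape Γ) : (T.map f).right₀ = T.right₀.map f :=
  (Turing.ListBlank.map_cons f T.right T.head).symm

variable {us : List Γ'} {T : Turing.Tape Γ} (hT : T.right₀.map f = .mk us)

include hT in
theorem head_of_map_right₀ : f T.head = us.headI := by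
  simpa [Turing.Tape.right₀] using congrArg Turing.ListBlank.head hT

include hT in
theorem map_right₀_move_right : (T.move .right).right₀.map f = .mk us.tail := by
  simpa [Turing.Tape.right₀, Turing.Tape.move] using congrArg Turing.ListBlank.tail hT

end MapTape

namespace RevMachine

/-- The control states of `sweep`. -/
inductive SweepState : Type
  | start | right | read | halt

instance : Finite SweepState :=
  .of_surjective ![.start, .right, .read, .halt] fun
    | .start => ⟨0, rfl⟩
    | .right => ⟨1, rfl⟩
    | .read => ⟨2, rfl⟩
    | .halt => ⟨3, rfl⟩

section Sweep

variable {ι Γ : Type} [DecidableEq ι] [Inhabited Γ]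

/-- The transitions of `sweep`. -/
inductive SweepTrans (i j : ι) (f old : Γ → Γ) :
    SweepState → Instr ι Γ → SweepState → Prop
  | enter {v : ι → Γ} : f (v i) = default → v j = default →
      SweepTrans i j f old .start (.write v v) .right
  | right : SweepTrans i j f old .right (.move (bothDir i j .right)) .read
  | loop {v : ι → Γ} : f (v i) ≠ default → v j = old (f (v i)) →
      SweepTrans i j f old .read (.write v (update v j (f (v i)))) .right
  | exit {v : ι → Γ} : f (v i) = default → v j = default →
      SweepTrans i j f old .read (.write v v) .halt

/-- The machine that walks to the right along the tapes `i` and `j`, from a cell before a block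
of symbols `a` of tape `i` with `f a ≠ default` to the end of that block, while on tape `j` it
replaces `old (f a)` by `f a`. The old symbol is determined by the new one, so that this can be
undone. -/
def sweep {i j : ι} (hij : i ≠ j) (f old : Γ → Γ) : RevMachine ι Γ where
  State := SweepState
  finite_state := inferInstance
  Trans := SweepTrans i j f old
  start := .start
  halt := .halt
  det := by
    rintro _ _ _ _ _ (⟨hi, hj⟩ | _ | ⟨hi, hj⟩ | ⟨hi, hj⟩) (⟨hi', hj'⟩ | _ | ⟨hi', hj'⟩ | ⟨hi', hj'⟩)
    · exact Instr.write_clash_or_eq fun h => ⟨h, rfl⟩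
    · exact .inr ⟨rfl, rfl⟩
    · exact Instr.write_clash_or_eq fun h => ⟨by rw [h], rfl⟩
    · exact .inl fun h => hi (h ▸ hi')
    · exact .inl fun h => hi' (h ▸ hi)
    · exact Instr.write_clash_or_eq fun h => ⟨h, rfl⟩
  codet := by
    have enter_ne_loop {v w : ι → Γ} (hv : f (v i) = default) (hw : f (w i) ≠ default) :
        v ≠ update w j (f (w i)) := by
      rintro rfl
      exact hw (by simpa [hij] using hv)
    rintro _ _ _ _ _ (⟨hi, hj⟩ | _ | ⟨hi, hj⟩ | ⟨hi, hj⟩) (⟨hi', hj'⟩ | _ | ⟨hi', hj'⟩ | ⟨hi', hj'⟩)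
    · exact Instr.inv_write_clash_or_eq fun h => ⟨h, rfl⟩
    · exact .inl (enter_ne_loop hi hi')
    · exact .inr ⟨rfl, rfl⟩
    · exact .inl (enter_ne_loop hi' hi).symm
    · exact Instr.inv_write_clash_or_eq fun h => ⟨eq_of_update_eq_update_apply hij hj hj' h, rfl⟩
    · exact Instr.inv_write_clash_or_eq fun h => ⟨h, rfl⟩
  not_trans_start := nofun
  not_halt_trans := nofun

variable {i j : ι} (hij : i ≠ j) (τ : ι → Turing.Tape Γ)

section Steps

variable {f old : Γ → Γ} {T T' : Turing.Tape Γ}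

theorem sweep_step_enter (hT : f T.head = default) (hT' : T'.head = default) :
    (sweep hij f old).Step (.start, setPair τ i j T T') (.right, setPair τ i j T T') :=
  Step.write_self
    (.enter (by rwa [setPair_left _ _ _ hij]) (by rwa [setPair_right]))

theorem sweep_step_right :
    (sweep hij f old).Step (.right, setPair τ i j T T')
      (.read, setPair τ i j (T.move .right) (T'.move .right)) :=
  ⟨_, .right, (shift_bothDir hij τ T T' .right).symm⟩

theorem sweep_step_loop (hT : f T.head ≠ default) (hT' : T'.head = old (f T.head)) :
    (sweep hij f old).Step (.read, setPair τ i j T T')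
      (.right, setPair τ i j T (T'.write (f T.head))) := by
  have hi : setPair τ i j T T' i = T := setPair_left τ T T' hij
  have hj : setPair τ i j T T' j = T' := setPair_right τ T T'
  have step := Step.write_update (M := sweep hij f old)
    (SweepTrans.loop (v := fun l => (setPair τ i j T T' l).head) (by rwa [hi]) (by rwa [hi, hj]))
  rwa [update_setPair_right, hi, hj] at step

theorem sweep_step_exit (hT : f T.head = default) (hT' : T'.head = default) :
    (sweep hij f old).Step (.read, setPair τ i j T T') (.halt, setPair τ i j T T') :=
  Step.write_self
    (.exit (by rwa [setPair_left _ _ _ hij]) (by rwa [setPair_right]))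

end Steps

variable (f : Turing.PointedMap Γ Γ) (old : Γ → Γ) {us : List Γ} (hus : default ∉ us)
  (T : Turing.Tape Γ)

/-- The position `n` cells further to the right on a tape. -/
abbrev moveRightBy {Γ : Type} [Inhabited Γ] (n : ℕ) : Turing.Tape Γ → Turing.Tape Γ :=
  (Turing.Tape.move .right)^[n]

include hus in
theorem sweep_read_reaches (hT : T.right₀.map f = .mk us) (L : Turing.ListBlank Γ) :
    ReflTransGen (sweep hij f old).Step
      (.read, setPair τ i j T (.mk' L (.mk (us.map old))))
      ((sweep hij f old).halt, setPair τ i j (moveRightBy us.length T)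
        (moveRightBy us.length (.mk' L (.mk us)))) := by
  induction us generalizing T L with
  | nil => exact .single (sweep_step_exit hij τ (head_of_map_right₀ f hT) rfl)
  | cons u us ih =>
    have hhead : f T.head = u := head_of_map_right₀ f hT
    have htail := map_right₀_move_right f hT
    have hus' := List.mem_cons.not.1 hus
    push Not at hus'
    have loop := sweep_step_loop hij τ (old := old) (T := T)
      (T' := .mk' L (.mk ((u :: us).map old))) (hhead.trans_ne hus'.1.symm) (by simp [hhead])
    have right := sweep_step_right hij τ (f := f) (old := old) (T := T)
      (T' := .mk' L (.mk (u :: us.map old)))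
    refine .head (b := _) (by simpa [hhead] using loop) (.head right ?_)
    simpa using ih hus'.2 _ htail (L.cons u)

include hus in
theorem sweep_computes (hT : f T.head = default) (hT' : (T.move .right).right₀.map f = .mk us)
    (L : Turing.ListBlank Γ) :
    (sweep hij f old).Computes (setPair τ i j T (.mk' L (.mk (default :: us.map old))))
      (setPair τ i j (moveRightBy (us.length + 1) T)
        (moveRightBy (us.length + 1) (.mk' L (.mk (default :: us))))) := by
  refine .head (sweep_step_enter hij τ hT rfl) (.head (sweep_step_right hij τ) ?_)
  simpa [moveRightBy] using sweep_read_reaches hij τ f old hus _ hT' (L.cons default)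

end Sweep

section Copier

variable {ι Γ : Type} [DecidableEq ι] [Inhabited Γ] {i j : ι} (hij : i ≠ j)

/-- The machine that appends to the blank tape `j` the images under `f` of the symbols of the block
of tape `i` which begins under the head, and returns both heads: it sweeps to the right while
copying, and comes back by undoing a sweep that changes nothing. -/
def copier (f : Γ → Γ) : RevMachine ι Γ :=
  (((mover (bothDir i j .left)).seq (sweep hij f fun _ => default)).seq
    (sweep hij f id).inv).seq (mover (bothDir i j .right))

theorem mk_replicate_default {Γ : Type} [Inhabited Γ] (n : ℕ) :
    Turing.ListBlank.mk (List.replicate n (default : Γ)) = .mk [] :=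
  (Quotient.sound' (Or.inl ⟨n, by simp⟩)).symm

theorem mk_singleton_default {Γ : Type} [Inhabited Γ] :
    Turing.ListBlank.mk [(default : Γ)] = .mk [] :=
  mk_replicate_default 1

theorem copier_computes (τ : ι → Turing.Tape Γ) (f : Turing.PointedMap Γ Γ) {us : List Γ}
    (hus : default ∉ us) (hj : τ j = .mk₁ []) (hleft : f ((τ i).move .left).head = default)
    (hi : (τ i).right₀.map f = .mk us) :
    (copier hij f).Computes τ (update τ j (.mk₁ us)) := by
  set T := (τ i).move .left with hT
  have hTi : T.move .right = τ i := by simp [hT]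
  have start : (mover (bothDir i j .left)).Computes τ
      (setPair τ i j T (.mk' (.mk []) (.mk (default :: us.map fun _ => default)))) := by
    have blank : (Turing.Tape.mk₁ [] : Turing.Tape Γ).move .left =
        .mk' (.mk []) (.mk (default :: us.map fun _ => default)) := by
      rw [List.map_const', ← List.replicate_succ, mk_replicate_default]
      simp [Turing.Tape.mk₁, Turing.Tape.mk₂, mk_singleton_default]
    have := mover_computes (bothDir i j .left) (setPair τ i j (τ i) (τ j))
    rwa [shift_bothDir hij, setPair_self, hj, blank] at this
  have copy := sweep_computes hij τ f (fun _ => default) hus T hleft (by rwa [hTi]) (.mk [])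
  have back := (sweep_computes hij τ f id hus T hleft (by rwa [hTi]) (.mk [])).inv
  have leave : (mover (bothDir i j .right)).Computes
      (setPair τ i j T (.mk' (.mk []) (.mk (default :: us.map id)))) (update τ j (.mk₁ us)) := by
    have word : (Turing.Tape.mk' (.mk []) (.mk (default :: us.map id))).move .right =
        Turing.Tape.mk₁ us := by
      simp [Turing.Tape.mk₁, Turing.Tape.mk₂, mk_singleton_default]
    have := mover_computes (bothDir i j .right)
      (setPair τ i j T (.mk' (.mk []) (.mk (default :: us.map id))))
    rwa [shift_bothDir hij, word, hTi, setPair_self_left] at this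
  exact ((start.seq copy).seq back).seq leave

end Copier

end RevMachine

section History

variable {Γ₀ Λ : Type} [Inhabited Γ₀] [Inhabited Λ] (M : Turing.TM0.Machine Γ₀ Λ)

/-- The symbol that `M` leaves on the cell it scans, where a halting machine changes nothing. -/
def writtenSymbol (q : Λ) (a : Γ₀) : Γ₀ :=
  match M q a with
  | some (_, .write b) => b
  | _ => a

/-- The head movement of `M`, where a halting machine does not move. -/
def headMove (q : Λ) (a : Γ₀) : Option Turing.Dir :=
  match M q a with
  | some (_, .move d) => some d
  | _ => none

/-- The tape that `M` leaves after one step. -/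
def tapeAfter (q : Λ) (T : Turing.Tape Γ₀) : Turing.Tape Γ₀ :=
  shift (headMove M q T.head) (T.write (writtenSymbol M q T.head))

/-- The state that `M` enters after an entry of the history, which is the state left and the symbol
then read; `none` is the entry that begins the history. As a result, `none` means halting. -/
def nextState : Option (Λ × Γ₀) → Option Λ
  | none => some default
  | some (q, a) => (M q a).map Prod.fst

variable {M}

theorem map_shift {Γ : Type} [Inhabited Γ] (f : Turing.PointedMap Γ₀ Γ)
    (d : Option Turing.Dir) (T : Turing.Tape Γ₀) :
    shift d (T.map f) = (shift d T).map f := by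
  cases d <;> simp [shift, Turing.Tape.map_move]

theorem tapeAfter_of_step {q q' : Λ} {T T' : Turing.Tape Γ₀}
    (h : Turing.TM0.step M ⟨q, T⟩ = some ⟨q', T'⟩) :
    nextState M (some (q, T.head)) = some q' ∧ tapeAfter M q T = T' := by
  cases hM : M q T.head with
  | none => simp [Turing.TM0.step, hM] at h
  | some p =>
    rcases p with ⟨p, d | b⟩ <;>
      simp_all [Turing.TM0.step, tapeAfter, writtenSymbol, headMove, nextState, shift]

theorem tapeAfter_of_halted {q : Λ} {T : Turing.Tape Γ₀}
    (h : Turing.TM0.step M ⟨q, T⟩ = none) :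
    nextState M (some (q, T.head)) = none ∧ tapeAfter M q T = T := by
  have hM : M q T.head = none := by simpa [Turing.TM0.step] using h
  simp [tapeAfter, writtenSymbol, headMove, nextState, shift, hM]

namespace RevMachine

/-- The control states of `historian`. -/
inductive HistoryState (Γ₀ Λ : Type) : Type
  | rest (o : Option Λ)
  | read (q : Λ)
  | wrote (q : Λ) (a : Γ₀)
  | log (p : Option (Λ × Γ₀))

instance [Finite Γ₀] [Finite Λ] : Finite (HistoryState Γ₀ Λ) :=
  .of_surjective (α := (Option Λ ⊕ Λ) ⊕ ((Λ × Γ₀) ⊕ Option (Λ × Γ₀)))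
    (Sum.elim (Sum.elim .rest .read) (Sum.elim (fun p => .wrote p.1 p.2) .log)) fun
    | .rest o => ⟨.inl (.inl o), rfl⟩
    | .read q => ⟨.inl (.inr q), rfl⟩
    | .wrote q a => ⟨.inr (.inl (q, a)), rfl⟩
    | .log p => ⟨.inr (.inr p), rfl⟩

variable {ι Γ : Type} [DecidableEq ι] [Inhabited Γ]

/-- The transitions of `historian`. -/
inductive HistoryTrans (M : Turing.TM0.Machine Γ₀ Λ) (work hist : ι) (emb : Γ₀ → Γ)
    (enc : Option (Λ × Γ₀) → Γ) :
    HistoryState Γ₀ Λ → Instr ι Γ → HistoryState Γ₀ Λ → Prop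
  | log {v : ι → Γ} {p} : v hist = default →
      HistoryTrans M work hist emb enc (.log p) (.write v (update v hist (enc p)))
        (.rest (nextState M p))
  | advance {q} : HistoryTrans M work hist emb enc (.rest (some q))
      (.move (update (fun _ => none) hist (some .right))) (.read q)
  | write {v : ι → Γ} {q a} : v work = emb a →
      HistoryTrans M work hist emb enc (.read q)
        (.write v (update v work (emb (writtenSymbol M q a)))) (.wrote q a)
  | move {q a} : HistoryTrans M work hist emb enc (.wrote q a)
      (.move (update (fun _ => none) work (headMove M q a))) (.log (some (q, a)))

/-- Bennett's simulation of `M` on the tape `work`: each step is preceded by writing down, on the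
tape `hist`, the state and the symbol which the previous step has overwritten. -/
def historian [Finite Γ₀] [Finite Λ] (M : Turing.TM0.Machine Γ₀ Λ) (work hist : ι)
    {emb : Γ₀ → Γ} (hemb : Injective emb) {enc : Option (Λ × Γ₀) → Γ} (henc : Injective enc) :
    RevMachine ι Γ where
  State := HistoryState Γ₀ Λ
  finite_state := inferInstance
  Trans := HistoryTrans M work hist emb enc
  start := .log none
  halt := .rest none
  det := by
    rintro _ _ _ _ _ (⟨hv⟩ | _ | ⟨hv⟩ | _) (⟨hw⟩ | _ | ⟨hw⟩ | _)
    · exact Instr.write_clash_or_eq fun h => ⟨by rw [h], rfl⟩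
    · exact .inr ⟨rfl, rfl⟩
    · refine Instr.write_clash_or_eq fun h => ?_
      have ha := hemb (hv.symm.trans ((congrFun h work).trans hw))
      exact ⟨by rw [h, ha], by rw [ha]⟩
    · exact .inr ⟨rfl, rfl⟩
  codet := by
    intro q i a j b h₁ h₂
    cases h₁ with
    | log hv =>
      generalize hr : HistoryState.rest _ = r at h₂
      cases h₂ with
      | log hw =>
        refine Instr.inv_write_clash_or_eq fun h => ⟨?_, ?_⟩
        · exact eq_of_update_eq_update (hv.trans hw.symm) h
        · exact congrArg HistoryState.log (henc (by simpa using congrFun h hist))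
      | _ => cases hr
    | advance => cases h₂; exact .inr ⟨rfl, rfl⟩
    | write hv =>
      cases h₂ with
      | write hw =>
        exact Instr.inv_write_clash_or_eq fun h =>
          ⟨eq_of_update_eq_update (hv.trans hw.symm) h, rfl⟩
    | move => cases h₂; exact .inr ⟨rfl, rfl⟩
  not_trans_start := nofun
  not_halt_trans := nofun

section Simulation

variable [Finite Γ₀] [Finite Λ] (work hist : ι) (hne : work ≠ hist)
  {emb : Turing.PointedMap Γ₀ Γ} (hemb : Injective emb)
  {enc : Option (Λ × Γ₀) → Γ} (henc : Injective enc)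

theorem historian_step_log (τ : ι → Turing.Tape Γ) (T : Turing.Tape Γ)
    (L : Turing.ListBlank Γ) (p : Option (Λ × Γ₀)) :
    (historian M work hist hemb henc).Step
      (.log p, setPair τ work hist T (.mk' L (.mk [])))
      (.rest (nextState M p), setPair τ work hist T (.mk' L (.mk [enc p]))) := by
  have step := Step.write_update (M := historian M work hist hemb henc)
    (HistoryTrans.log (p := p)
      (v := fun i => (setPair τ work hist T (.mk' L (.mk [])) i).head)
      (by rw [setPair_right]; rfl))
  rw [update_setPair_right, setPair_right] at step
  simpa using step

variable {work hist}

include hne in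
theorem historian_round (τ : ι → Turing.Tape Γ) {p : Option (Λ × Γ₀)} {q : Λ}
    (hp : nextState M p = some q) (T : Turing.Tape Γ₀) (L : Turing.ListBlank Γ) :
    ReflTransGen (historian M work hist hemb henc).Step
      (.log p, setPair τ work hist (T.map emb) (.mk' L (.mk [])))
      (.log (some (q, T.head)),
        setPair τ work hist ((tapeAfter M q T).map emb) (.mk' (L.cons (enc p)) (.mk []))) := by
  set N := historian M work hist hemb henc
  have hright : shift (some .right) (.mk' L (.mk [enc p])) = .mk' (L.cons (enc p)) (.mk []) := by
    simp [shift]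
  have log := historian_step_log (M := M) work hist hemb henc τ (T.map emb) L p
  have advance := Step.move_update (M := N)
    (τ := setPair τ work hist (T.map emb) (.mk' L (.mk [enc p]))) (HistoryTrans.advance (q := q))
  have write := Step.write_update (M := N)
    (HistoryTrans.write (a := T.head) (q := q)
      (v := fun i => (setPair τ work hist (T.map emb) (.mk' (L.cons (enc p)) (.mk [])) i).head)
      (by simp [setPair_left _ _ _ hne]))
  have move := Step.move_update (M := N)
    (τ := setPair τ work hist ((T.write (writtenSymbol M q T.head)).map emb)
      (.mk' (L.cons (enc p)) (.mk []))) (HistoryTrans.move (a := T.head) (q := q))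
  rw [hp] at log
  simp only [update_setPair_left, update_setPair_right, setPair_left, setPair_right, hne, ne_eq,
    not_false_eq_true, hright, ← Turing.Tape.map_write, map_shift] at advance write move
  exact .head log (.head advance (.head write (.single move)))

include hne in
theorem exists_historian_reaches {c c' : Turing.TM0.Cfg Γ₀ Λ} (h : Turing.TM0.Reaches M c c')
    (halted : Turing.TM0.step M c' = none) {p : Option (Λ × Γ₀)} (hp : nextState M p = some c.q)
    (L : Turing.ListBlank Γ) :
    ∃ X, ∀ τ : ι → Turing.Tape Γ, ReflTransGen (historian M work hist hemb henc).Step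
      (.log p, setPair τ work hist (c.Tape.map emb) (.mk' L (.mk [])))
      (.rest none, setPair τ work hist (c'.Tape.map emb) X) := by
  induction h using ReflTransGen.head_induction_on generalizing p L with
  | refl =>
    obtain ⟨next, tape⟩ := tapeAfter_of_halted halted
    refine ⟨.mk' (L.cons (enc p)) (.mk [enc (some (c'.q, c'.Tape.head))]), fun τ => ?_⟩
    have round := historian_round hne hemb henc τ hp c'.Tape L
    have log := historian_step_log (M := M) work hist hemb henc τ (c'.Tape.map emb)
      (L.cons (enc p)) (some (c'.q, c'.Tape.head))
    rw [tape] at round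
    rw [next] at log
    exact round.tail log
  | head step _ ih =>
    obtain ⟨next, tape⟩ := tapeAfter_of_step step
    obtain ⟨X, hX⟩ := ih next (L.cons (enc p))
    refine ⟨X, fun τ => (historian_round hne hemb henc τ hp _ L).trans ?_⟩
    rw [tape]
    exact hX τ

include hne in
theorem exists_historian_computes {T : Turing.Tape Γ₀} {c : Turing.TM0.Cfg Γ₀ Λ}
    (h : Turing.TM0.Reaches M ⟨default, T⟩ c) (halted : Turing.TM0.step M c = none) :
    ∃ X, ∀ τ : ι → Turing.Tape Γ, (historian M work hist hemb henc).Computes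
      (setPair τ work hist (T.map emb) (.mk₁ [])) (setPair τ work hist (c.Tape.map emb) X) :=
  exists_historian_reaches hne hemb henc h halted rfl _

end Simulation

end RevMachine

end History

section Evaluation

open Turing.PartrecToTM2 (Γ' K' Cont' trList trNat trPosNum)

theorem exists_finite_machine {Γ Λ : Type} [Inhabited Γ] [Inhabited Λ]
    {M : Turing.TM0.Machine Γ Λ} {S : Finset Λ} (hS : Turing.TM0.Supports M S) :
    ∃ (Λ' : Type) (_ : Finite Λ') (_ : Inhabited Λ') (M' : Turing.TM0.Machine Γ Λ'),
      ∀ l, ∀ L ∈ Turing.TM0.eval M l, L ∈ Turing.TM0.eval M' l := by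
  classical
  let : Inhabited S := ⟨⟨default, hS.1⟩⟩
  let toS : Turing.PointedMap Λ S :=
    ⟨fun q => if h : q ∈ S then ⟨q, h⟩ else default, dif_pos hS.1⟩
  let idΓ : Turing.PointedMap Γ Γ := ⟨id, rfl⟩
  have map_idΓ (L : Turing.ListBlank Γ) : L.map idΓ = L := Turing.ListBlank.ext fun n => by
    simp [idΓ]
  refine ⟨S, inferInstance, inferInstance, M.map idΓ idΓ toS Subtype.val, fun l L hL => ?_⟩
  have respects := M.map_respects idΓ idΓ toS Subtype.val hS (fun _ => rfl)
    fun q hq => congrArg Subtype.val (dif_pos hq)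
  obtain ⟨⟨q, T⟩, hc, rfl⟩ := (Part.mem_map_iff _).1 hL
  obtain ⟨_, ⟨-, rfl⟩, hc'⟩ := StateTransition.tr_eval respects ⟨hS.1, rfl⟩ hc
  refine (Part.mem_map_iff _).2 ⟨⟨toS q, T.map idΓ⟩, ?_, ?_⟩
  · have init : (Turing.TM0.init l).map idΓ toS = Turing.TM0.init l := by
      rw [Turing.TM0.map_init]
      exact congrArg _ (List.map_id l)
    rwa [init] at hc'
  · simp only [Turing.Tape.right₀, Turing.Tape.map, map_idΓ]
    rfl

/-- The positive number whose binary expansion is `1w`. -/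
def posNum (w : List Bool) : PosNum :=
  w.foldl (fun n b => PosNum.bit b n) 1

/-- The number whose binary expansion is `1w`, which represents the word `w` in Mathlib's evaluation
of codes by a machine. -/
def num (w : List Bool) : ℕ := posNum w

/-- The digit `b` in the stack alphabet of Mathlib's machine for codes. -/
def digit (b : Bool) : Γ' := if b then .bit1 else .bit0

theorem posNum_append_singleton (w : List Bool) (b : Bool) :
    posNum (w ++ [b]) = PosNum.bit b (posNum w) := by
  simp [posNum]

theorem trNat_num (w : List Bool) :
    trNat (num w) = (w.reverse.map digit) ++ [.bit1] := by
  have digits : trPosNum (posNum w) = (w.reverse.map digit) ++ [.bit1] := by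
    induction w using List.reverseRecOn with
    | nil => rfl
    | append_singleton w b ih =>
      rw [posNum_append_singleton]
      cases b <;> simp [PosNum.bit, trPosNum, ih, digit]
  rw [← digits, trNat, num, PosNum.of_to_nat]
  rfl

/-- The alphabet of Mathlib's one-tape machine for codes: four stacks of symbols, laid out next to
each other along the tape, and a marker for the cell where the stacks begin. -/
abbrev StackSym : Type := Turing.TM2to1.Γ' K' fun _ => Γ'

instance : Finite StackSym :=
  have : Finite K' := .of_surjective (α := Fin 4) ![.main, .rev, .aux, .stack] fun
    | .main => ⟨0, rfl⟩
    | .rev => ⟨1, rfl⟩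
    | .aux => ⟨2, rfl⟩
    | .stack => ⟨3, rfl⟩
  inferInstanceAs (Finite (Bool × _))

/-- The first cell of the tape of Mathlib's machine when a single number is on the main stack. -/
def bottomCell : StackSym := (true, update (fun _ => none) .main (some .cons))

/-- A cell of the tape of Mathlib's machine that holds a digit of the main stack. -/
def digitCell (b : Bool) : StackSym := (false, update (fun _ => none) .main (some (digit b)))

/-- The digit, if any, that a stack symbol stands for. -/
def symDigit : Turing.PointedMap (Option Γ') (Option Bool) where
  f
    | some .bit0 => some false
    | some .bit1 => some true
    | _ => none
  map_pt' := rfl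

/-- The digit of the main stack, if any, that a cell of the tape of Mathlib's machine holds. -/
def cellDigit : Turing.PointedMap StackSym (Option Bool) := ⟨fun s => symDigit (s.2 .main), rfl⟩

theorem map_cellDigit_addBottom (L : Turing.ListBlank (K' → Option Γ')) :
    (Turing.TM2to1.addBottom L).map cellDigit = (L.map (Turing.proj .main)).map symDigit :=
  Turing.ListBlank.ext fun n => by
    simp only [Turing.ListBlank.nth_map, cellDigit, ← Turing.TM2to1.addBottom_nth_snd L n]
    rfl

theorem trInit_num (w : List Bool) :
    Turing.TM2to1.trInit K'.main (trList [num w]) =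
      bottomCell :: (true :: w).map digitCell := by
  simp only [Turing.TM2to1.trInit, trList, trNat_num, List.reverse_append,
    List.reverse_cons, List.reverse_nil, ← List.map_reverse, List.reverse_reverse]
  exact congrArg (bottomCell :: digitCell true :: ·) (List.map_map ..)

theorem exists_machine_of_code (c : Turing.ToPartrec.Code) :
    ∃ (Λ : Type) (_ : Finite Λ) (_ : Inhabited Λ) (M : Turing.TM0.Machine StackSym Λ),
      ∀ w u, [num u] ∈ c.eval [num w] →
        ∃ L ∈ Turing.TM0.eval M (bottomCell :: (true :: w).map digitCell),
          L.map cellDigit = .mk (none :: (true :: u).map some) := by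
  let : Inhabited Turing.PartrecToTM2.Λ' := ⟨Turing.PartrecToTM2.trNormal c Cont'.halt⟩
  have supports := Turing.TM1to0.tr_supports _ (Turing.TM2to1.tr_supports _
    (Turing.PartrecToTM2.tr_supports c Cont'.halt))
  obtain ⟨Λ, hΛ, iΛ, M, hM⟩ := exists_finite_machine supports
  refine ⟨Λ, hΛ, iΛ, M, fun w u h => ?_⟩
  have eval : trList [num u] ∈
      Turing.TM2.eval Turing.PartrecToTM2.tr .main (trList [num w]) := by
    have init : Turing.TM2.init K'.main (trList [num w]) =
        Turing.PartrecToTM2.init c [num w] := by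
      refine congrArg _ (funext fun k => ?_)
      cases k <;> rfl
    exact (Part.mem_map_iff _).2 ⟨Turing.PartrecToTM2.halt [num u], by
      rw [init, Turing.PartrecToTM2.tr_eval]; exact Part.mem_map _ h, rfl⟩
  obtain ⟨L, hL⟩ := Part.dom_iff_mem.1
    ((Turing.TM2to1.tr_eval_dom _ _ _).2 (Part.dom_iff_mem.2 ⟨_, eval⟩))
  obtain ⟨S, L', rfl, hL', hS⟩ := Turing.TM2to1.tr_eval _ _ _ hL eval
  refine ⟨Turing.TM2to1.addBottom L', hM _ _ ?_, ?_⟩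
  · rwa [← trInit_num, Turing.TM1to0.tr_eval]
  · rw [map_cellDigit_addBottom, hL', hS]
    have digits : (fun b => symDigit (some (digit b))) = some := funext fun b => by cases b <;> rfl
    have reversed : ((trList [num u]).map some).reverse =
        some .cons :: some .bit1 :: u.map fun b => some (digit b) := by
      simp [trNat_num, ← List.map_reverse, Function.comp_def]
    rw [reversed, Turing.ListBlank.map_mk]
    simp only [List.map_cons, List.map_map, Function.comp_def, digits]
    rfl

end Evaluation

namespace RevMachine

section Stacking

variable {ι Γ : Type} [Inhabited Γ] [DecidableEq ι] {τ : ι → Turing.Tape Γ} {i j : ι}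

theorem mover_update_computes (i : ι) (d : Turing.Dir) (τ : ι → Turing.Tape Γ) :
    (mover (update (fun _ => none) i (some d))).Computes τ (update τ i ((τ i).move d)) :=
  .single (Step.move_update (M := mover (update (fun _ => none) i (some d))) (i := i)
    (d := some d) (by exact ⟨rfl, rfl, rfl⟩))

/-- The machine that writes `a` in front of the word on tape `i`. -/
def pusher (i : ι) (a : Γ) : RevMachine ι Γ :=
  (mover (update (fun _ => none) i (some .left))).seq (rewriter i default a)

theorem pusher_computes {l : List Γ} (h : τ i = .mk₁ l) (a : Γ) :
    (pusher i a).Computes τ (update τ i (.mk₁ (a :: l))) := by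
  have move := mover_update_computes i .left τ
  have rewrite := rewriter_computes i a (update τ i ((τ i).move .left))
  rw [update_idem, update_self, h] at rewrite
  rw [h] at move
  refine move.seq (N := rewriter i default a) ?_
  simpa [Turing.Tape.mk₁, Turing.Tape.mk₂, Turing.Tape.write_mk'] using rewrite

theorem copier_id_computes (hij : i ≠ j) {us : List Γ} (hus : default ∉ us) (hi : τ i = .mk₁ us)
    (hj : τ j = .mk₁ []) : (copier hij id).Computes τ (update τ j (.mk₁ us)) := by
  refine copier_computes hij τ ⟨id, rfl⟩ hus hj (by rw [hi]; rfl) ?_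
  rw [hi, Turing.Tape.mk₁, Turing.Tape.mk₂, Turing.Tape.mk'_right₀, Turing.ListBlank.map_mk]
  exact congrArg _ (List.map_id us)

/-- The machine that moves a word from tape `i` to the blank tape `j`. -/
def transfer (hij : i ≠ j) : RevMachine ι Γ :=
  (copier hij id).seq (copier hij.symm id).inv

theorem transfer_computes (hij : i ≠ j) {us : List Γ} (hus : default ∉ us) (hi : τ i = .mk₁ us)
    (hj : τ j = .mk₁ []) :
    (transfer hij).Computes τ (setPair τ i j (.mk₁ []) (.mk₁ us)) := by
  have uncopy := copier_id_computes hij.symm (τ := setPair τ i j (.mk₁ []) (.mk₁ us)) hus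
    (setPair_right _ _ _) (setPair_left _ _ _ hij)
  rw [update_setPair_left _ _ _ hij, ← hi, setPair_self_left, hi] at uncopy
  exact (copier_id_computes hij hus hi hj).seq uncopy.inv

end Stacking

end RevMachine

section Evaluator

variable {A : Type}

/-- The representation of stack symbols by tape symbols that is given by `cell`, except that the
blanks correspond to each other. -/
noncomputable def embed (cell : StackSym → A) : Turing.PointedMap StackSym (Sym A) :=
  open Classical in ⟨fun s => if s = default then .blank else .aux (cell s), if_pos rfl⟩

theorem embed_injective {cell : StackSym → A} (hcell : Injective cell) :
    Injective (embed cell) := by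
  intro s t h
  by_cases hs : s = default <;> by_cases ht : t = default
  · rw [hs, ht]
  · simp [embed, hs, ht] at h
  · simp [embed, hs, ht] at h
  · exact hcell (by simpa [embed, hs, ht] using h)

/-- Translation of bits into cells of the tape of Mathlib's machine for codes. -/
noncomputable def loadSym (cell : StackSym → A) : Turing.PointedMap (Sym A) (Sym A) where
  f
    | .bit b => embed cell (digitCell b)
    | _ => .blank
  map_pt' := rfl

/-- A bit, if any, as a tape symbol. -/
def bitSym : Turing.PointedMap (Option Bool) (Sym A) := ⟨fun o => o.elim .blank .bit, rfl⟩

/-- Translation of cells of the tape of Mathlib's machine for codes into bits. -/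
noncomputable def unloadSym {cell : StackSym → A} (hcell : Injective cell) :
    Turing.PointedMap (Sym A) (Sym A) where
  f a := bitSym (cellDigit (invFun (embed cell) a))
  map_pt' := by
    have h := leftInverse_invFun (embed_injective hcell) default
    rw [(embed cell).map_pt] at h
    rw [h, cellDigit.map_pt]
    rfl

theorem unloadSym_embed {cell : StackSym → A} (hcell : Injective cell) (s : StackSym) :
    unloadSym hcell (embed cell s) = bitSym (cellDigit s) :=
  congrArg (fun t => bitSym (cellDigit t)) (leftInverse_invFun (embed_injective hcell) s)

theorem map_unloadSym_map_embed {cell : StackSym → A} (hcell : Injective cell)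
    (L : Turing.ListBlank StackSym) :
    (L.map (embed cell)).map (unloadSym hcell) = (L.map cellDigit).map bitSym :=
  Turing.ListBlank.ext fun n => by simp only [Turing.ListBlank.nth_map, unloadSym_embed]

namespace RevMachine

variable {ι Λ : Type} [DecidableEq ι] [Finite Λ] [Inhabited Λ]
  {M : Turing.TM0.Machine StackSym Λ} {i j work hist : ι} {cell : StackSym → A}
  {entry : Option (Λ × StackSym) → Sym A} {τ : ι → Turing.Tape (Sym A)}

theorem loader_computes (hcell : Injective cell) (hi : i ≠ work) {w : List Bool}
    (hw : τ i = wordTape A w) (hwork : τ work = .mk₁ []) :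
    ((copier hi (loadSym cell)).seq (pusher work (embed cell bottomCell))).Computes τ
      (update τ work ((Turing.Tape.mk₁ (bottomCell :: w.map digitCell)).map (embed cell))) := by
  set cells := (w.map digitCell).map (embed cell) with hcells
  have mem_cells : default ∉ cells := by
    rw [hcells, List.map_map, List.mem_map]
    rintro ⟨b, -, hb⟩
    have := embed_injective hcell (hb.trans (embed cell).map_pt.symm)
    cases b <;> cases congrArg cellDigit this
  have load := copier_computes hi τ (loadSym cell) (us := cells) mem_cells hwork
    (by rw [hw]; rfl) (by
      rw [hw, wordTape, Turing.Tape.mk₁, Turing.Tape.mk₂, Turing.Tape.mk'_right₀,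
        Turing.ListBlank.map_mk, List.map_map, hcells, List.map_map]
      rfl)
  have push := pusher_computes (update_self work (.mk₁ cells) τ) (embed cell bottomCell)
  rw [update_idem] at push
  rw [Turing.Tape.map_mk₁]
  exact load.seq push

/-- The machine that simulates `M` on the word on tape `i`, as the number on the main stack, and
leaves the head of tape `work` on the result. -/
noncomputable def forward (M : Turing.TM0.Machine StackSym Λ) (hi : i ≠ work) (hist : ι)
    (hcell : Injective cell) (hentry : Injective entry) : RevMachine ι (Sym A) :=
  (((copier hi (loadSym cell)).seq (pusher work (embed cell bottomCell))).seq
    (historian M work hist (embed_injective hcell) hentry)).seq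
    (mover (update (fun _ => none) work (some .right)))

theorem exists_forward_computes (hi : i ≠ work) (hne : work ≠ hist) (hcell : Injective cell)
    (hentry : Injective entry) {w : List Bool} {L : Turing.ListBlank StackSym}
    (hL : L ∈ Turing.TM0.eval M (bottomCell :: w.map digitCell)) :
    ∃ (T : Turing.Tape StackSym) (X : Turing.Tape (Sym A)), T.right₀ = L ∧
      ∀ τ, τ i = wordTape A w → τ work = .mk₁ [] → τ hist = .mk₁ [] →
        (forward M hi hist hcell hentry).Computes τ
          (setPair τ work hist ((T.map (embed cell)).move .right) X) := by
  obtain ⟨c, hc, rfl⟩ := (Part.mem_map_iff _).1 hL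
  obtain ⟨reaches, halted⟩ := StateTransition.mem_eval.1 hc
  obtain ⟨X, hX⟩ := exists_historian_computes hne (embed_injective hcell) hentry reaches halted
  refine ⟨c.Tape, X, rfl, fun τ hw hwork hhist => ?_⟩
  have load := loader_computes hcell hi hw hwork
  have simulate := hX τ
  rw [setPair, update_comm hne, ← hhist, update_eq_self] at simulate
  have right := mover_update_computes work .right
    (setPair τ work hist (c.Tape.map (embed cell)) X)
  rw [update_setPair_left _ _ _ hne, setPair_left _ _ _ hne] at right
  exact (load.seq simulate).seq right

theorem unloader_computes (hcell : Injective cell) (hj : work ≠ j) {T : Turing.Tape StackSym}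
    {u : List Bool} (hT : T.right₀.map cellDigit = .mk (none :: u.map some))
    (hwork : τ work = (T.map (embed cell)).move .right) (hblank : τ j = .mk₁ []) :
    (copier hj (unloadSym hcell)).Computes τ (update τ j (wordTape A u)) := by
  refine copier_computes hj τ _ (by simp) hblank ?_ ?_
  · rw [hwork, Turing.Tape.move_right_left]
    exact (unloadSym_embed hcell _).trans (congrArg bitSym (head_of_map_right₀ cellDigit hT))
  · rw [hwork, ← Turing.Tape.map_move, right₀_map, map_unloadSym_map_embed,
      map_right₀_move_right cellDigit hT, List.tail_cons, Turing.ListBlank.map_mk, List.map_map]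
    rfl

theorem exists_evaluator (M : Turing.TM0.Machine StackSym Λ) (hcell : Injective cell)
    (hentry : Injective entry) (hi : i ≠ work) (hne : work ≠ hist) (hij : i ≠ j)
    (hj : j ≠ work) (hj' : j ≠ hist) :
    ∃ N : RevMachine ι (Sym A), ∀ {w u : List Bool},
      (∃ L ∈ Turing.TM0.eval M (bottomCell :: w.map digitCell),
        L.map cellDigit = .mk (none :: u.map some)) →
      ∀ τ, τ i = wordTape A w → τ j = .mk₁ [] → τ work = .mk₁ [] → τ hist = .mk₁ [] →
        N.Computes τ (update τ j (wordTape A u)) := by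
  refine ⟨((forward M hi hist hcell hentry).seq (copier hj.symm (unloadSym hcell))).seq
    (forward M hi hist hcell hentry).inv, ?_⟩
  rintro w u ⟨L, hL, hu⟩ τ hw hblank hwork hhist
  obtain ⟨T, X, rfl, hX⟩ := exists_forward_computes hi hne hcell hentry hL
  have unload := unloader_computes (τ := setPair τ work hist ((T.map (embed cell)).move .right) X)
    hcell hj.symm hu (setPair_left _ _ _ hne) (by rw [setPair_of_ne _ _ _ hj hj', hblank])
  have restore := (hX (update τ j (wordTape A u)) (by rwa [update_of_ne hij])
    (by rwa [update_of_ne hj.symm]) (by rwa [update_of_ne hj'.symm])).inv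
  rw [setPair, update_comm hj, update_comm hj'] at restore
  exact ((hX τ hw hwork hhist).seq unload).seq restore

end RevMachine

end Evaluator

section Recursion

variable {α β : Type} [Primcodable α] [Primcodable β]

theorem rePred_comp {P : β → Prop} (hP : REPred P) {f : α → β} (hf : Computable f) :
    REPred fun a => P (f a) :=
  Partrec.comp hP hf

theorem rePred_and {P Q : α → Prop} (hP : REPred P) (hQ : REPred Q) :
    REPred fun a => P a ∧ Q a :=
  (hP.bind (rePred_comp hQ .fst).to₂).dom_re.of_eq fun a => by simp [Part.bind_dom, Part.assert]

theorem rePred_exists_nat {P : α → ℕ → Prop} (hP : PrimrecRel P) :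
    REPred fun a => ∃ n, P a n := by
  classical
  have search : Partrec fun a => Nat.rfind ((fun n => decide (P a n) : ℕ → Bool) : ℕ →. Bool) :=
    Partrec.rfind (hP.decide.to_comp.partrec.to₂)
  exact search.dom_re.of_eq fun a => by simp [Nat.rfind_dom]

theorem exists_primrecRel_of_rePred {P : α → Prop} (hP : REPred P) :
    ∃ Q : α → ℕ → Prop, PrimrecRel Q ∧ ∀ a, P a ↔ ∃ n, Q a n := by
  obtain ⟨c, hc⟩ := Nat.Partrec.Code.exists_code.1 hP
  refine ⟨fun a n => (c.evaln n (Encodable.encode a)).isSome, ?_, fun a => ?_⟩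
  · have eval : Primrec₂ fun (a : α) n => c.evaln n (Encodable.encode a) :=
      Nat.Partrec.Code.primrec_evaln.comp
        ((Primrec.snd.pair (.const c)).pair (Primrec.encode.comp .fst))
    exact Primrec.eq.comp (Primrec.option_isSome.comp eval) (.const true)
  · have dom : P a ↔ (c.eval (Encodable.encode a)).Dom := by simp [hc, Part.assert]
    simp only [dom, Part.dom_iff_mem, Nat.Partrec.Code.evaln_complete, Option.isSome_iff_exists]
    exact exists_comm

theorem exists_partrec_choice {P : α × β → Prop} (hP : REPred P) :
    ∃ g : α →. β, Partrec g ∧ (∀ a, ∀ b ∈ g a, P (a, b)) ∧ ∀ a b, P (a, b) → (g a).Dom := by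
  classical
  obtain ⟨Q, hQ, hPQ⟩ := exists_primrecRel_of_rePred hP
  let guess (a : α) (n : ℕ) : Option β :=
    (Encodable.decode n : Option (β × ℕ)).bind fun x => if Q (a, x.1) x.2 then some x.1 else none
  have guess_primrec : Primrec₂ guess := by
    refine Primrec.option_bind (Primrec.decode.comp .snd) (Primrec.ite ?_ ?_ (.const none))
    · exact hQ.comp ((Primrec.fst.comp .fst).pair (Primrec.fst.comp .snd)) (Primrec.snd.comp .snd)
    · exact Primrec.option_some.comp (Primrec.fst.comp .snd)
  refine ⟨fun a => Nat.rfindOpt (guess a), Partrec.rfindOpt guess_primrec.to_comp,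
    fun a b hb => ?_, fun a b h => ?_⟩
  · obtain ⟨n, hn⟩ := Nat.rfindOpt_spec hb
    obtain ⟨⟨b', m⟩, -, h⟩ := Option.bind_eq_some_iff.1 hn
    obtain ⟨hQ', rfl⟩ : Q (a, b') m ∧ b' = b := by simpa using h
    exact (hPQ _).2 ⟨m, hQ'⟩
  · obtain ⟨m, hm⟩ := (hPQ _).1 h
    exact Nat.rfindOpt_dom.2 ⟨Encodable.encode (b, m), b, by simp [guess, hm]⟩

theorem exists_partrec_graph {P : α × β → Prop} (hP : REPred P)
    (unique : ∀ {a b b'}, P (a, b) → P (a, b') → b = b') :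
    ∃ g : α →. β, Partrec g ∧ ∀ a b, b ∈ g a ↔ P (a, b) := by
  obtain ⟨g, hg, sound, total⟩ := exists_partrec_choice hP
  refine ⟨g, hg, fun a b => ⟨sound a b, fun h => ?_⟩⟩
  obtain ⟨b', hb'⟩ := Part.dom_iff_mem.1 (total a b h)
  rwa [unique h (sound a b' hb')]

theorem exists_partrec_leftInverse {f : β → α} (hf : Computable f) (inj : Injective f) :
    ∃ g : α →. β, Partrec g ∧ ∀ b, b ∈ g (f b) := by
  classical
  have rePred : REPred fun x : α × β => f x.2 = x.1 :=
    ComputablePred.to_re ⟨fun _ => inferInstance,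
      Primrec.eq.decide.to_comp.comp (hf.comp .snd) .fst⟩
  obtain ⟨g, hg, mem_iff⟩ := exists_partrec_graph rePred fun h h' => inj (h.trans h'.symm)
  exact ⟨g, hg, fun b => (mem_iff _ _).2 rfl⟩

end Recursion

section Realization

theorem num_append_singleton (w : List Bool) (b : Bool) :
    num (w ++ [b]) = 2 * num w + b.toNat := by
  rw [num, posNum_append_singleton, num]
  cases b <;> simp [PosNum.bit] <;> ring

theorem num_eq_foldl (w : List Bool) : num w = w.foldl (fun m b => 2 * m + b.toNat) 1 := by
  induction w using List.reverseRecOn with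
  | nil => rfl
  | append_singleton w b ih => simp [num_append_singleton, ih]

theorem primrec_num : Primrec num := by
  refine (Primrec.list_foldl (f := id) (g := fun _ => 1)
    (h := fun _ x => 2 * x.1 + x.2.toNat) .id (.const 1) ?_).of_eq fun w => (num_eq_foldl w).symm
  exact Primrec.nat_add.comp
    (Primrec.nat_mul.comp (.const 2) (Primrec.fst.comp .snd))
    ((Primrec.dom_finite Bool.toNat).comp (Primrec.snd.comp .snd))

theorem num_injective : Injective num := by
  intro v w h
  have digit_injective : Injective digit := by
    rintro (_ | _) (_ | _) h <;> first | rfl | cases h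
  have digits := congrArg Turing.PartrecToTM2.trNat h
  rw [trNat_num, trNat_num] at digits
  simpa [List.map_injective_iff.2 digit_injective |>.eq_iff] using digits

theorem exists_code_num {f : List Bool →. List Bool} (hf : Partrec f) :
    ∃ c : Turing.ToPartrec.Code, ∀ w u, u ∈ f w → [num u] ∈ c.eval [num w] := by
  obtain ⟨g, hg, num_inverse⟩ :=
    exists_partrec_leftInverse primrec_num.to_comp num_injective
  have partrec : Partrec fun m => ((g m).bind f).map num :=
    (hg.bind (hf.comp .snd).to₂).map (primrec_num.to_comp.comp .snd).to₂
  obtain ⟨c, hc⟩ := Turing.ToPartrec.Code.exists_code (Nat.Partrec'.part_iff₁.2 partrec)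
  refine ⟨c, fun w u hu => ?_⟩
  have eval : c.eval [num w] = _ := hc (num w ::ᵥ .nil)
  rw [eval]
  exact Part.mem_map _ (Part.mem_map _ (Part.mem_bind (num_inverse w) hu))

/-- Four tapes, the first two of which hold words. -/
def twoWords (A : Type) (v w : List Bool) : Fin 4 → Turing.Tape (Sym A) :=
  ![wordTape A v, wordTape A w, wordTape A [], wordTape A []]

theorem update_twoWords_zero {A : Type} (u v w : List Bool) :
    update (twoWords A u w) 0 (wordTape A v) = twoWords A v w := by
  ext l : 1
  fin_cases l <;> rfl

theorem update_twoWords_one {A : Type} (u v w : List Bool) :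
    update (twoWords A u v) 1 (wordTape A w) = twoWords A u w := by
  ext l : 1
  fin_cases l <;> rfl

theorem exists_evaluator_of_partrec {f : List Bool →. List Bool} (hf : Partrec f) :
    ∃ (B : Type) (_ : Finite B), ∀ {A : Type} {e : B → A}, Injective e →
      (∃ N : RevMachine (Fin 4) (Sym A), ∀ {w u}, u ∈ f w →
        N.Computes (twoWords A (true :: w) []) (twoWords A (true :: w) (true :: u))) ∧
      ∃ N : RevMachine (Fin 4) (Sym A), ∀ {w u}, u ∈ f w →
        N.Computes (twoWords A [] (true :: w)) (twoWords A (true :: u) (true :: w)) := by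
  obtain ⟨c, hc⟩ := exists_code_num hf
  obtain ⟨Λ, _, _, M, hM⟩ := exists_machine_of_code c
  refine ⟨StackSym ⊕ Option (Λ × StackSym), inferInstance, fun {A e} he => ?_⟩
  have hcell : Injective (e ∘ Sum.inl) := he.comp Sum.inl_injective
  have hentry : Injective (Sym.aux ∘ e ∘ Sum.inr) :=
    Injective.comp (fun _ _ => Sym.aux.inj) (he.comp Sum.inr_injective)
  constructor
  · obtain ⟨N, hN⟩ := RevMachine.exists_evaluator (ι := Fin 4) (i := 0) (j := 1) (work := 2)
      (hist := 3) M hcell hentry (by decide) (by decide) (by decide) (by decide) (by decide)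
    refine ⟨N, fun {w u} h => ?_⟩
    rw [← update_twoWords_one (true :: w) [] (true :: u)]
    exact hN (hM _ _ (hc _ _ h)) (twoWords A _ _) rfl rfl rfl rfl
  · obtain ⟨N, hN⟩ := RevMachine.exists_evaluator (ι := Fin 4) (i := 1) (j := 0) (work := 2)
      (hist := 3) M hcell hentry (by decide) (by decide) (by decide) (by decide) (by decide)
    refine ⟨N, fun {w u} h => ?_⟩
    rw [← update_twoWords_zero [] (true :: u) (true :: w)]
    exact hN (hM _ _ (hc _ _ h)) (twoWords A _ _) rfl rfl rfl rfl

namespace RevMachine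

variable {A : Type}

theorem pusher_computes_twoWords (v w : List Bool) :
    (pusher 0 (.bit true)).Computes (twoWords A v w) (twoWords A (true :: v) w) := by
  rw [← update_twoWords_zero v (true :: v) w]
  exact pusher_computes (τ := twoWords A v w) (l := v.map Sym.bit) rfl (.bit true)

theorem transfer_zero_one_computes (v : List Bool) :
    (transfer (Fin.zero_ne_one (n := 2))).Computes (twoWords A v []) (twoWords A [] v) := by
  rw [← update_twoWords_one [] [] v, ← update_twoWords_zero v [] []]
  exact transfer_computes (τ := twoWords A v []) _ (us := v.map Sym.bit) (by simp [default]) rfl rfl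

theorem transfer_one_zero_computes (v : List Bool) :
    (transfer (Fin.zero_ne_one (n := 2)).symm).Computes (twoWords A [] v) (twoWords A v []) := by
  rw [← update_twoWords_zero [] v [], ← update_twoWords_one [] v []]
  exact transfer_computes (τ := twoWords A [] v) _ (us := v.map Sym.bit) (by simp [default]) rfl rfl

theorem toTM_cleanCfg [Finite A] (M : RevMachine (Fin 4) (Sym A)) (q : Option M.State)
    (w : List Bool) : M.toTM.cleanCfg q w = ⟨q, twoWords A w []⟩ := by
  refine Cfg.ext rfl (funext fun l => ?_)
  fin_cases l <;> rfl

end RevMachine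

theorem exists_outputs_of_partrec {f : List Bool →. List Bool} (hf : Partrec f) :
    ∃ T : TM, ∀ w u, u ∈ f w → T.Outputs w u := by
  obtain ⟨B, _, hB⟩ := exists_evaluator_of_partrec hf
  obtain ⟨N, hN⟩ := (hB injective_id).2
  refine ⟨(((RevMachine.pusher 0 (.bit true)).seq (.transfer Fin.zero_ne_one)).seq N).seq
    (RevMachine.pusher 0 (.bit true)).inv |>.toTM, fun w u h => ?_⟩
  obtain ⟨m, hm⟩ := RevMachine.exists_run_of_reflTransGen _
    ((((RevMachine.pusher_computes_twoWords w []).seq (RevMachine.transfer_zero_one_computes _)).seq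
      (hN h)).seq (RevMachine.pusher_computes_twoWords u (true :: w)).inv)
  rw [← RevMachine.toTM_cleanCfg] at hm
  exact ⟨m, m, le_rfl, _, hm, rfl, rfl⟩

theorem exists_reversible_of_partrec {f g : List Bool →. List Bool} (hf : Partrec f)
    (hg : Partrec g) :
    ∃ R : TM, R.Reversible ∧ ∀ w u, u ∈ f w → w ∈ g u → R.OutputsClean w u := by
  obtain ⟨B, _, hB⟩ := exists_evaluator_of_partrec hf
  obtain ⟨B', _, hB'⟩ := exists_evaluator_of_partrec hg
  obtain ⟨N, hN⟩ := (hB (A := B ⊕ B') Sum.inl_injective).1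
  obtain ⟨N', hN'⟩ := (hB' (A := B ⊕ B') Sum.inr_injective).2
  refine ⟨((((RevMachine.pusher 0 (.bit true)).seq N).seq N'.inv).seq
    (.transfer Fin.zero_ne_one.symm)).seq (RevMachine.pusher 0 (.bit true)).inv |>.toTM,
    RevMachine.toTM_reversible _, fun w u h h' => ?_⟩
  obtain ⟨m, hm⟩ := RevMachine.exists_run_of_reflTransGen _
    (((((RevMachine.pusher_computes_twoWords w []).seq (hN h)).seq (hN' h').inv).seq
      (RevMachine.transfer_one_zero_computes _)).seq (RevMachine.pusher_computes_twoWords u []).inv)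
  rw [← RevMachine.toTM_cleanCfg, ← RevMachine.toTM_cleanCfg] at hm
  exact ⟨m, hm⟩

end Realization

section HalfTapes

variable {Γ : Type} [Inhabited Γ]

open Classical in
/-- `a :: l`, except that a default symbol is not put in front of the empty list. In this way, lists
without trailing default symbols are produced from such lists. -/
noncomputable def trimCons (a : Γ) (l : List Γ) : List Γ :=
  if a = default ∧ l = [] then [] else a :: l

theorem tail_trimCons (a : Γ) (l : List Γ) : (trimCons a l).tail = l := by
  rw [trimCons]
  split_ifs with h
  · exact h.2.symm
  · rfl

theorem headI_trimCons (a : Γ) (l : List Γ) : (trimCons a l).headI = a := by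
  rw [trimCons]
  split_ifs with h
  · exact h.1.symm
  · rfl

theorem mk_trimCons (a : Γ) (l : List Γ) :
    Turing.ListBlank.mk (trimCons a l) = (Turing.ListBlank.mk l).cons a := by
  rw [trimCons]
  split_ifs with h
  · rw [h.1, h.2]
    exact (Turing.ListBlank.cons_head_tail (Turing.ListBlank.mk [])).symm
  · rfl

theorem foldr_trimCons_replicate (n : ℕ) :
    (List.replicate n (default : Γ)).foldr trimCons [] = [] := by
  induction n with
  | zero => rfl
  | succ n ih => simp [List.replicate_succ, ih, trimCons]

/-- The shortest list that represents a half-tape. -/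
noncomputable def trim (L : Turing.ListBlank Γ) : List Γ :=
  L.liftOn (fun l => l.foldr trimCons []) <| by
    rintro a b ⟨n, rfl⟩
    simp [List.foldr_append, foldr_trimCons_replicate]

theorem trim_mk (l : List Γ) : trim (Turing.ListBlank.mk l) = l.foldr trimCons [] := rfl

theorem trim_cons (a : Γ) (L : Turing.ListBlank Γ) : trim (L.cons a) = trimCons a (trim L) := by
  induction L using Turing.ListBlank.induction_on with
  | h l => rfl

theorem trim_tail (L : Turing.ListBlank Γ) : trim L.tail = (trim L).tail := by
  conv_rhs => rw [← L.cons_head_tail, trim_cons, tail_trimCons]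

theorem headI_trim (L : Turing.ListBlank Γ) : (trim L).headI = L.head := by
  conv_lhs => rw [← L.cons_head_tail, trim_cons, headI_trimCons]

theorem mk_trim (L : Turing.ListBlank Γ) : Turing.ListBlank.mk (trim L) = L := by
  induction L using Turing.ListBlank.induction_on with
  | h l =>
    rw [trim_mk]
    induction l with
    | nil => rfl
    | cons a l ih => rw [List.foldr_cons, mk_trimCons, ih, Turing.ListBlank.cons_mk]

theorem trim_injective : Injective (trim : Turing.ListBlank Γ → List Γ) :=
  LeftInverse.injective mk_trim

theorem primrec_trimCons [Primcodable Γ] : Primrec₂ (trimCons : Γ → List Γ → List Γ) := by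
  classical
  exact Primrec.ite ((Primrec.eq.comp .fst (.const default)).and (Primrec.eq.comp .snd (.const [])))
    (.const []) (Primrec.list_cons.comp .fst .snd)

end HalfTapes

section TapeCodes

/-- Codes of tapes: the symbols to the left of the head (the nearest first), the scanned symbol, and
the symbols to the right of the head. Unlike `Turing.Tape`, this is a `Primcodable` type. -/
abbrev TapeCode (Γ : Type) : Type := List Γ × Γ × List Γ

/-- The code of a tape, in which both half-tapes are without trailing blanks. -/
noncomputable def tapeCode {Γ : Type} [Inhabited Γ] (T : Turing.Tape Γ) : TapeCode Γ :=
  (trim T.left, T.head, trim T.right)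

theorem tapeCode_injective {Γ : Type} [Inhabited Γ] :
    Injective (tapeCode : Turing.Tape Γ → TapeCode Γ) := by
  rintro ⟨a, l, r⟩ ⟨a', l', r'⟩ h
  simp only [tapeCode, Prod.mk.injEq, trim_injective.eq_iff] at h
  simp [h]

variable {A : Type}

/-- The code of `wordTape`. -/
def wordCode (A : Type) (w : List Bool) : TapeCode (Sym A) :=
  ([], (w.map Sym.bit).headI, (w.map Sym.bit).tail)

theorem trim_map_bit (w : List Bool) :
    trim (Turing.ListBlank.mk (w.map (Sym.bit : Bool → Sym A))) = w.map Sym.bit := by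
  rw [trim_mk]
  induction w with
  | nil => rfl
  | cons b w ih =>
    rw [List.map_cons, List.foldr_cons, ih, trimCons, if_neg]
    exact fun h => by cases h.1

theorem tapeCode_wordTape (w : List Bool) : tapeCode (wordTape A w) = wordCode A w := by
  have tail : (w.map (Sym.bit : Bool → Sym A)).tail = w.tail.map Sym.bit := by simp
  simp only [tapeCode, wordTape, Turing.Tape.mk₁, Turing.Tape.mk₂, Turing.Tape.mk', wordCode,
    Turing.ListBlank.head_mk, Turing.ListBlank.tail_mk, tail, trim_map_bit]
  rfl

theorem wordTape_injective (A : Type) : Injective (wordTape A) := by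
  have bit_injective : Injective (Sym.bit : Bool → Sym A) := fun _ _ => Sym.bit.inj
  intro v w h
  have codes := congrArg tapeCode h
  simp only [tapeCode_wordTape, wordCode, Prod.mk.injEq, true_and] at codes
  obtain _ | ⟨a, v⟩ := v <;> obtain _ | ⟨b, w⟩ := w
  · rfl
  · cases codes.1
  · cases codes.1
  · simp only [List.map_cons, List.headI_cons, List.tail_cons] at codes
    rw [bit_injective codes.1, List.map_injective_iff.2 bit_injective codes.2]

open Classical in
/-- The effect of `act` on codes. -/
noncomputable def actCode (a : Sym A × Option Turing.Dir) (t : TapeCode (Sym A)) :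
    TapeCode (Sym A) :=
  if a.2 = none then (t.1, a.1, t.2.2)
  else if a.2 = some Turing.Dir.left then (t.1.tail, t.1.headI, trimCons a.1 t.2.2)
  else (trimCons a.1 t.1, t.2.2.headI, t.2.2.tail)

theorem tapeCode_act (a : Sym A × Option Turing.Dir) (T : Turing.Tape (Sym A)) :
    tapeCode (act a T) = actCode a (tapeCode T) := by
  obtain ⟨a, _ | _ | _⟩ := a <;> obtain ⟨h, l, r⟩ := T <;>
    simp [act, actCode, tapeCode, Turing.Tape.write, Turing.Tape.move, trim_cons, trim_tail,
      headI_trim]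

end TapeCodes

namespace TM

variable (M : TM)

/-- Codes of instantaneous descriptions. -/
abbrev CfgCode : Type := Option M.Q × (Fin (M.k + 1) → TapeCode (Sym M.A))

/-- The code of an instantaneous description. -/
noncomputable def cfgCode (c : Cfg M) : M.CfgCode := (c.state, fun i => tapeCode (c.tape i))

theorem cfgCode_injective : Injective M.cfgCode := by
  intro c c' h
  simp only [cfgCode, Prod.mk.injEq] at h
  exact Cfg.ext h.1 (funext fun i => tapeCode_injective (congrFun h.2 i))

/-- The effect of `step` on codes. -/
noncomputable def stepCode (c : M.CfgCode) : Option M.CfgCode :=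
  c.1.bind fun q =>
    (M.δ q fun i => (c.2 i).2.1).map fun p => (p.1, fun i => actCode (p.2 i) (c.2 i))

theorem stepCode_cfgCode (c : Cfg M) : M.stepCode (M.cfgCode c) = (M.step c).map M.cfgCode := by
  obtain ⟨_ | q, τ⟩ := c
  · rfl
  · simp only [stepCode, cfgCode, step, Option.bind_some, tapeCode]
    cases h : M.δ q fun i => (τ i).head with
    | none => simp
    | some p =>
      simp only [Option.map_some, Option.some.injEq, cfgCode, Prod.mk.injEq, true_and]
      funext i
      exact (tapeCode_act _ _).symm

/-- The effect of `run` on codes. -/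
noncomputable def runCode (n : ℕ) (c : M.CfgCode) : Option M.CfgCode :=
  (·.bind M.stepCode)^[n] (some c)

theorem run_succ' (n : ℕ) (c : Cfg M) : M.run (n + 1) c = (M.run n c).bind M.step := by
  induction n generalizing c with
  | zero =>
    simp only [run, Option.bind_some]
    cases M.step c <;> rfl
  | succ n ih =>
    rw [run, run]
    cases M.step c with
    | none => rfl
    | some c' => exact ih c'

theorem runCode_cfgCode (n : ℕ) (c : Cfg M) :
    M.runCode n (M.cfgCode c) = (M.run n c).map M.cfgCode := by
  induction n with
  | zero => rfl
  | succ n ih =>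
    rw [runCode, iterate_succ_apply', ← runCode, ih, run_succ']
    cases M.run n c with
    | none => rfl
    | some d => exact M.stepCode_cfgCode d

/-- The code of `cleanCfg`. -/
def cleanCode (q : Option M.Q) (w : List Bool) : M.CfgCode :=
  (q, fun i => if i = 0 then wordCode M.A w else wordCode M.A [])

theorem cfgCode_cleanCfg (q : Option M.Q) (w : List Bool) :
    M.cfgCode (M.cleanCfg q w) = M.cleanCode q w := by
  refine Prod.ext rfl (funext fun i => ?_)
  by_cases h : i = 0 <;> simp [cfgCode, cleanCfg, cleanCode, h, tapeCode_wordTape]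

theorem outputs_iff_exists_runCode (w u : List Bool) : M.Outputs w u ↔
    ∃ n, (M.runCode n (M.cleanCode (some M.start) w)).map (fun c => (c.1, c.2 0)) =
      some (none, wordCode M.A u) := by
  have outputs_iff : M.Outputs w u ↔
      ∃ n c, M.run n (M.init w) = some c ∧ c.state = none ∧ c.tape 0 = wordTape M.A u :=
    ⟨fun ⟨_, m, _, h⟩ => ⟨m, h⟩, fun ⟨m, h⟩ => ⟨m, m, le_rfl, h⟩⟩
  refine outputs_iff.trans (exists_congr fun n => ?_)
  rw [← cfgCode_cleanCfg, runCode_cfgCode, ← init]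
  cases M.run n (M.init w) with
  | none => simp
  | some c => simp [cfgCode, ← tapeCode_wordTape, tapeCode_injective.eq_iff]

theorem outputsClean_iff_exists_runCode (w u : List Bool) : M.OutputsClean w u ↔
    ∃ n, M.runCode n (M.cleanCode (some M.start) w) = some (M.cleanCode none u) := by
  refine exists_congr fun n => ?_
  rw [← cfgCode_cleanCfg, runCode_cfgCode, ← init, ← cfgCode_cleanCfg]
  cases M.run n (M.init w) <;> simp [M.cfgCode_injective.eq_iff]

section Computability

instance : Finite Turing.Dir :=
  Finite.of_injective (fun d => decide (d = Turing.Dir.left)) (by rintro (_ | _) (_ | _) <;> simp)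

noncomputable instance : Primcodable Turing.Dir := .ofEquiv _ (Finite.equivFin Turing.Dir)

instance : Finite M.Q := M.finQ

noncomputable instance : Primcodable M.Q := .ofEquiv _ (Finite.equivFin M.Q)

instance : Finite (Sym M.A) := by
  have := M.finA
  let symbol : Bool ⊕ Option M.A → Sym M.A
    | .inl b => .bit b
    | .inr none => .blank
    | .inr (some a) => .aux a
  refine Finite.of_surjective symbol fun
    | .bit b => ⟨.inl b, rfl⟩
    | .blank => ⟨.inr none, rfl⟩
    | .aux a => ⟨.inr (some a), rfl⟩

noncomputable instance : Primcodable (Sym M.A) := .ofEquiv _ (Finite.equivFin (Sym M.A))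

theorem primrec_actCode :
    Primrec₂ (actCode : Sym M.A × Option Turing.Dir → TapeCode (Sym M.A) → _) := by
  classical
  let Args := (Sym M.A × Option Turing.Dir) × TapeCode (Sym M.A)
  have symbol : Primrec fun x : Args => x.1.1 := Primrec.fst.comp .fst
  have dir : Primrec fun x : Args => x.1.2 := Primrec.snd.comp .fst
  have leftSyms : Primrec fun x : Args => x.2.1 := Primrec.fst.comp .snd
  have rightSyms : Primrec fun x : Args => x.2.2.2 := Primrec.snd.comp (Primrec.snd.comp .snd)
  exact Primrec.ite (Primrec.eq.comp dir (.const none)) (leftSyms.pair (symbol.pair rightSyms))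
    (Primrec.ite (Primrec.eq.comp dir (.const (some Turing.Dir.left)))
      ((Primrec.list_tail.comp leftSyms).pair
        ((Primrec.list_headI.comp leftSyms).pair (primrec_trimCons.comp symbol rightSyms)))
      ((primrec_trimCons.comp symbol leftSyms).pair
        ((Primrec.list_headI.comp rightSyms).pair (Primrec.list_tail.comp rightSyms))))

theorem primrec_stepCode : Primrec M.stepCode := by
  have transition : Primrec fun x : M.Q × (Fin (M.k + 1) → Sym M.A) => M.δ x.1 x.2 :=
    Primrec.dom_finite _
  have heads : Primrec fun c : M.CfgCode => fun i => (c.2 i).2.1 :=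
    Primrec.fin_curry.2 (Primrec.fst.comp (Primrec.snd.comp
      (Primrec.fin_app.comp (Primrec.snd.comp .fst) .snd)))
  have acts : Primrec₂ fun (x : M.CfgCode × M.Q)
      (p : Option M.Q × (Fin (M.k + 1) → Sym M.A × Option Turing.Dir)) =>
      (p.1, fun i => actCode (p.2 i) (x.1.2 i)) := by
    refine Primrec.pair (Primrec.fst.comp .snd) (Primrec.fin_curry.2 ?_)
    exact M.primrec_actCode.comp
      (Primrec.fin_app.comp (Primrec.snd.comp (Primrec.snd.comp .fst)) .snd)
      (Primrec.fin_app.comp (Primrec.snd.comp (Primrec.fst.comp (Primrec.fst.comp .fst))) .snd)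
  exact Primrec.option_bind .fst
    (Primrec.option_map (transition.comp (Primrec.pair .snd (heads.comp .fst))) acts)

theorem primrec_runCode : Primrec₂ M.runCode :=
  Primrec.nat_iterate .fst (Primrec.option_some.comp .snd)
    (Primrec.option_bind .snd (M.primrec_stepCode.comp .snd))

theorem primrec_wordCode : Primrec (wordCode M.A) := by
  have symbols : Primrec fun w : List Bool => w.map (Sym.bit : Bool → Sym M.A) :=
    Primrec.list_map .id ((Primrec.dom_finite _).comp .snd)
  exact (Primrec.const []).pair
    ((Primrec.list_headI.comp symbols).pair (Primrec.list_tail.comp symbols))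

theorem primrec_cleanCode (q : Option M.Q) : Primrec (M.cleanCode q) :=
  (Primrec.const q).pair (Primrec.fin_curry.2
    (Primrec.ite (Primrec.eq.comp .snd (.const 0)) (M.primrec_wordCode.comp .fst) (.const _)))

theorem rePred_outputs : REPred fun x : List Bool × List Bool => M.Outputs x.1 x.2 := by
  have run : Primrec₂ fun (x : List Bool × List Bool) n =>
      M.runCode n (M.cleanCode (some M.start) x.1) :=
    M.primrec_runCode.comp .snd ((M.primrec_cleanCode _).comp (Primrec.fst.comp .fst))
  have output : Primrec₂ fun (x : List Bool × List Bool) n =>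
      (M.runCode n (M.cleanCode (some M.start) x.1)).map fun c => (c.1, c.2 0) :=
    Primrec.option_map run ((Primrec.fst.comp .snd).pair
      (Primrec.fin_app.comp (Primrec.snd.comp .snd) (.const 0)))
  have expected : Primrec₂ fun (x : List Bool × List Bool) (_ : ℕ) =>
      some ((none : Option M.Q), wordCode M.A x.2) :=
    Primrec.option_some.comp
      ((Primrec.const none).pair (M.primrec_wordCode.comp (Primrec.snd.comp .fst)))
  exact (rePred_exists_nat (Primrec.eq.comp₂ output expected)).of_eq fun x =>
    (M.outputs_iff_exists_runCode x.1 x.2).symm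

theorem rePred_outputsClean : REPred fun x : List Bool × List Bool => M.OutputsClean x.1 x.2 := by
  have run : Primrec₂ fun (x : List Bool × List Bool) n =>
      M.runCode n (M.cleanCode (some M.start) x.1) :=
    M.primrec_runCode.comp .snd ((M.primrec_cleanCode _).comp (Primrec.fst.comp .fst))
  have expected : Primrec₂ fun (x : List Bool × List Bool) (_ : ℕ) =>
      some (M.cleanCode none x.2) :=
    Primrec.option_some.comp ((M.primrec_cleanCode none).comp (Primrec.snd.comp .fst))
  exact (rePred_exists_nat (Primrec.eq.comp₂ run expected)).of_eq fun x =>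
    (M.outputsClean_iff_exists_runCode x.1 x.2).symm

end Computability

end TM

section Words

theorem num_dropLast_bits_reverse {m : ℕ} (hm : m ≠ 0) : num m.bits.dropLast.reverse = m := by
  induction m using Nat.binaryRec' with
  | zero => contradiction
  | bit b m hb ih =>
    rw [Nat.bits_append_bit m b hb]
    obtain rfl | hm := eq_or_ne m 0
    · simp [hb rfl, num, posNum]
    · have bits_ne_nil : m.bits ≠ [] := fun h => hm (
        Nat.size_eq_zero.1 (by rw [← Nat.size_eq_bits_len, h, List.length_nil]))
      rw [List.dropLast_cons_of_ne_nil bits_ne_nil, List.reverse_cons, num_append_singleton, ih hm,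
        Nat.bit_val]

theorem num_word (m : ℕ) : num (word m) = m + 1 :=
  num_dropLast_bits_reverse m.succ_ne_zero

theorem word_injective : Injective word := fun m n h => by
  simpa [num_word] using congrArg num h

theorem length_word_le (m : ℕ) : (word m).length ≤ Nat.log 2 m + 1 := by
  have size_le : (m + 1).size ≤ Nat.log 2 m + 2 :=
    Nat.size_le.2 ((Nat.succ_le_of_lt (Nat.lt_pow_succ_log_self one_lt_two m)).trans_lt
      (Nat.pow_lt_pow_right one_lt_two (Nat.lt_succ_self _)))
  simpa [word, Nat.size_eq_bits_len] using size_le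

theorem computable_word : Computable word := by
  obtain ⟨g, hg, mem_num⟩ := exists_partrec_leftInverse primrec_num.to_comp num_injective
  refine Partrec.of_eq_tot (hg.comp Computable.succ) fun m => ?_
  simpa only [num_word] using mem_num (word m)

theorem length_pair (x y : List Bool) : (pair x y).length = 2 * x.length + 1 + y.length := by
  simp only [pair, List.length_append, List.length_replicate, List.length_cons]
  ring

theorem replicate_true_append_inj {m n : ℕ} {u v : List Bool}
    (h : List.replicate m true ++ false :: u = List.replicate n true ++ false :: v) :
    m = n ∧ u = v := by
  induction m generalizing n with
  | zero => cases n <;> simp_all [List.replicate_succ]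
  | succ m ih =>
    cases n with
    | zero => simp [List.replicate_succ] at h
    | succ n => simpa using ih (n := n) (by simpa [List.replicate_succ] using h)

theorem pair_inj {x y x' y' : List Bool} (h : pair x y = pair x' y') : x = x' ∧ y = y' := by
  obtain ⟨length_eq, append_eq⟩ := replicate_true_append_inj h
  exact List.append_inj append_eq length_eq

theorem primrec_pair : Primrec₂ pair := by
  have ones : Primrec₂ fun (x : List Bool) (_ : List Bool) => x.map fun _ : Bool => true :=
    Primrec.list_map .fst (.const true)
  refine (Primrec.list_append.comp₂ ones (Primrec.list_cons.comp₂ (.const false)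
    Primrec.list_append)).of_eq fun x y => ?_
  simp [pair, List.map_const']

theorem exists_partrec_unpair :
    ∃ g : List Bool →. List Bool × List Bool, Partrec g ∧ ∀ x y, (x, y) ∈ g (pair x y) := by
  obtain ⟨g, hg, mem_pair⟩ := exists_partrec_leftInverse (f := uncurry pair) primrec_pair.to_comp
    fun _ _ h => Prod.ext_iff.2 (pair_inj h)
  exact ⟨g, hg, fun x y => mem_pair (x, y)⟩

end Words

section Runs

variable {M : TM}

theorem TM.run_halted {c : Cfg M} (h : c.state = none) {n : ℕ} {c' : Cfg M}
    (hn : M.run n c = some c') : c' = c := by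
  cases n with
  | zero => exact (Option.some_injective _ hn).symm
  | succ n => simp [TM.run, TM.step, h] at hn

theorem TM.run_unique {c a b : Cfg M} (ha : a.state = none) (hb : b.state = none) {m n : ℕ}
    (hm : M.run m c = some a) (hn : M.run n c = some b) : a = b := by
  induction m generalizing n c with
  | zero =>
    obtain rfl := Option.some_injective _ hm
    exact (TM.run_halted ha hn).symm
  | succ m ih =>
    cases n with
    | zero =>
      obtain rfl := Option.some_injective _ hn
      exact TM.run_halted hb hm
    | succ n =>
      rw [TM.run] at hm hn
      obtain ⟨c', hc, hm⟩ := Option.bind_eq_some_iff.1 hm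
      rw [hc] at hn
      exact ih hm hn

theorem TM.Outputs.unique {w u v : List Bool} (hu : M.Outputs w u) (hv : M.Outputs w v) :
    u = v := by
  obtain ⟨_, m, _, a, hm, ha, hau⟩ := hu
  obtain ⟨_, n, _, b, hn, hb, hbv⟩ := hv
  rw [TM.run_unique ha hb hm hn] at hau
  exact wordTape_injective _ (hau.symm.trans hbv)

end Runs

section PartialFunctions

variable {M : TM}

theorem exists_partrec_mem_iff_outputs (M : TM) :
    ∃ f : List Bool →. List Bool, Partrec f ∧ ∀ w u, u ∈ f w ↔ M.Outputs w u :=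
  exists_partrec_graph M.rePred_outputs TM.Outputs.unique

theorem TM.Reversible.init_unique (hM : M.Reversible) {v w : List Bool} {c : Cfg M} {m n : ℕ}
    (hm : M.run m (M.init v) = some c) (hn : M.run n (M.init w) = some c) :
    M.init v = M.init w := by
  have init_not_entered (w : List Bool) {n : ℕ} {v : List Bool} :
      M.run (n + 1) (M.init v) ≠ some (M.init w) := fun h => by
    rw [M.run_succ'] at h
    obtain ⟨c', -, hc⟩ := Option.bind_eq_some_iff.1 h
    exact hM.2 _ _ hc rfl
  induction m generalizing n c with
  | zero =>
    obtain rfl := Option.some_injective _ hm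
    cases n with
    | zero => exact (Option.some_injective _ hn).symm
    | succ n => exact absurd hn (init_not_entered v)
  | succ m ih =>
    cases n with
    | zero =>
      obtain rfl := Option.some_injective _ hn
      exact absurd hm (init_not_entered w)
    | succ n =>
      rw [M.run_succ'] at hm hn
      obtain ⟨a, ha, hac⟩ := Option.bind_eq_some_iff.1 hm
      obtain ⟨b, hb, hbc⟩ := Option.bind_eq_some_iff.1 hn
      rw [← hM.1 _ _ _ hac hbc] at hb
      exact ih ha hb

theorem TM.Reversible.outputsClean_injective (hM : M.Reversible) {v w u : List Bool}
    (hv : M.OutputsClean v u) (hw : M.OutputsClean w u) : v = w := by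
  obtain ⟨m, hm⟩ := hv
  obtain ⟨n, hn⟩ := hw
  have tape_eq := congrFun (congrArg Cfg.tape (hM.init_unique hm hn)) 0
  exact wordTape_injective _ (by simpa [TM.init, TM.cleanCfg] using tape_eq)

theorem TM.Reversible.exists_partrec_inverse (hM : M.Reversible) :
    ∃ g : List Bool →. List Bool, Partrec g ∧ ∀ u w, w ∈ g u ↔ M.OutputsClean w u :=
  exists_partrec_graph (P := fun x => M.OutputsClean x.2 x.1)
    (rePred_comp M.rePred_outputsClean (Computable.snd.pair .fst)) hM.outputsClean_injective

end PartialFunctions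

section Complexity

variable {U : TM}

theorem IsUniversal.exists_index (hU : IsUniversal U) {f : List Bool →. List Bool}
    (hf : Partrec f) :
    ∃ i : List Bool, ∀ p y u, u ∈ f (pair p y) → U.Outputs (pair (pair i p) y) u := by
  obtain ⟨T, hT⟩ := exists_outputs_of_partrec hf
  obtain ⟨i, hi⟩ := hU T
  exact ⟨i, fun p y u h => (hi p y u).2 (hT _ _ h)⟩

theorem condC_le {p x y : List Bool} (h : U.Outputs (pair p y) x) : condC U x y ≤ p.length :=
  iInf₂_le p h

theorem exists_outputs_of_condC_lt_top {x y : List Bool} (h : condC U x y < ⊤) :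
    ∃ p, U.Outputs (pair p y) x ∧ condC U x y = p.length := by
  have : Nonempty {p : List Bool // U.Outputs (pair p y) x} := by
    by_contra no_program
    rw [nonempty_subtype, not_exists] at no_program
    simp [condC, no_program] at h
  obtain ⟨⟨p, hp⟩, hmin⟩ := ENat.exists_eq_iInf
    fun p : {p : List Bool // U.Outputs (pair p y) x} => (p.1.length : ℕ∞)
  exact ⟨p, hp, by rw [condC, iInf_subtype', ← hmin]⟩

theorem IsUniversal.exists_condC_le_length_add (hU : IsUniversal U)
    {f : List Bool →. List Bool} (hf : Partrec f) :
    ∃ c : ℕ, ∀ p y x, x ∈ f (pair p y) → condC U x y ≤ (p.length + c : ℕ) := by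
  obtain ⟨i, hi⟩ := hU.exists_index hf
  refine ⟨2 * i.length + 1, fun p y x h => (condC_le (hi p y x h)).trans ?_⟩
  rw [length_pair, add_comm]

theorem IsUniversal.exists_condC_le_length (hU : IsUniversal U) :
    ∃ c : ℕ, ∀ x y : List Bool, condC U x y ≤ (x.length + c : ℕ) := by
  obtain ⟨unpair, unpair_partrec, mem_unpair⟩ := exists_partrec_unpair
  obtain ⟨c, hc⟩ := hU.exists_condC_le_length_add
    (unpair_partrec.map (Computable.fst.comp .snd).to₂)
  exact ⟨c, fun x y => hc x y x (Part.mem_map _ (mem_unpair x y))⟩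

theorem IsUniversal.condC_lt_top (hU : IsUniversal U) (x y : List Bool) : condC U x y < ⊤ := by
  obtain ⟨c, hc⟩ := hU.exists_condC_le_length
  exact (hc x y).trans_lt (ENat.natCast_lt_top _)

theorem IsUniversal.exists_shortest_program (hU : IsUniversal U) (x y : List Bool) :
    ∃ p, U.Outputs (pair p y) x ∧ condC U x y = p.length :=
  exists_outputs_of_condC_lt_top (hU.condC_lt_top x y)

theorem C_le_Ct (U : TM) (t : ℕ → ℕ) (x : List Bool) : C U x ≤ Ct U t x :=
  le_iInf₂ fun _ hp => condC_le ⟨_, hp⟩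

theorem IsUniversal.tendsto_Ct (hU : IsUniversal U) (x : List Bool) {t : ℕ → ℕ → ℕ}
    (ht : Tendsto (fun n => t n x.length) atTop atTop) :
    Tendsto (fun n => Ct U (t n) x) atTop (𝓝 (C U x)) := by
  obtain ⟨p, ⟨m, k, hk, hp⟩, hC⟩ := hU.exists_shortest_program x []
  refine tendsto_const_nhds.congr' ?_
  filter_upwards [ht.eventually_ge_atTop m] with n hn
  refine (C_le_Ct U (t n) x).antisymm ?_
  rw [C, hC]
  exact iInf₂_le p ⟨k, hk.trans hn, hp⟩

end Complexity

section IrreversibilityCost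

variable {U R : TM}

theorem E_le {x y p q : List Bool} (h : R.OutputsClean (pair x p) (pair y q)) :
    E R x y ≤ (p.length + q.length : ℕ) :=
  (iInf₂_le p q).trans (iInf_le _ h)

theorem le_E_add_iff {a : ℕ∞} {x y : List Bool} {c : ℕ} : a ≤ E R x y + c ↔
    ∀ p q, R.OutputsClean (pair x p) (pair y q) → a ≤ (p.length + q.length + c : ℕ) := by
  simp only [E, ENat.iInf_add, le_iInf_iff, Nat.cast_add]

theorem IsUniversal.exists_C_le_E (hU : IsUniversal U) (hR : R.Reversible) :
    ∃ c : ℕ, ∀ x : List Bool, C U x ≤ E R x [] + c := by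
  obtain ⟨unpair, unpair_partrec, mem_unpair⟩ := exists_partrec_unpair
  obtain ⟨inv, inv_partrec, mem_inv⟩ := hR.exists_partrec_inverse
  have swap : Computable fun a : List Bool × (List Bool × List Bool) => pair a.2.2 a.2.1 :=
    primrec_pair.to_comp.comp (Computable.snd.comp .snd) (Computable.fst.comp .snd)
  have recover : Partrec fun w =>
      (((unpair w).map fun a => pair a.2 a.1).bind inv).bind fun v => (unpair v).map Prod.fst :=
    ((unpair_partrec.map swap.to₂).bind (inv_partrec.comp .snd).to₂).bind
      ((unpair_partrec.comp .snd).map (Computable.fst.comp .snd).to₂).to₂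
  obtain ⟨c, hc⟩ := hU.exists_condC_le_length_add recover
  refine ⟨c, fun x => le_E_add_iff.2 fun p q h => (hc q [] x ?_).trans ?_⟩
  · exact Part.mem_bind (Part.mem_bind (Part.mem_map _ (mem_unpair q [])) ((mem_inv _ _).2 h))
      (Part.mem_map _ (mem_unpair x p))
  · exact_mod_cast (by omega)

theorem exists_partrec_program_of_length (U : TM) :
    ∃ f : List Bool × List Bool →. List Bool, Partrec f ∧
      (∀ x p, ∀ z ∈ f (x, p),
        U.Outputs (pair p x) (word z.length) ∧ U.Outputs (pair z []) x) ∧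
      ∀ x p z, U.Outputs (pair p x) (word z.length) → U.Outputs (pair z []) x →
        (f (x, p)).Dom := by
  have computes_length := rePred_comp U.rePred_outputs
    (f := fun a : (List Bool × List Bool) × List Bool => (pair a.1.2 a.1.1, word a.2.length))
    ((primrec_pair.to_comp.comp (Computable.snd.comp .fst) (Computable.fst.comp .fst)).pair
      (computable_word.comp (Computable.list_length.comp .snd)))
  have computes_word := rePred_comp U.rePred_outputs
    (f := fun a : (List Bool × List Bool) × List Bool => (pair a.2 [], a.1.1))
    ((primrec_pair.to_comp.comp .snd (.const [])).pair (Computable.fst.comp .fst))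
  obtain ⟨f, hf, sound, total⟩ :=
    exists_partrec_choice (rePred_and computes_length computes_word)
  exact ⟨f, hf, fun x p => sound (x, p), fun x p z h h' => total (x, p) z ⟨h, h'⟩⟩

theorem IsUniversal.exists_partrec_shortest_program (hU : IsUniversal U) :
    ∃ f : List Bool × List Bool →. List Bool, Partrec f ∧
      ∀ x p, U.Outputs (pair p x) (word (C U x).toNat) →
        ∃ z ∈ f (x, p), U.Outputs (pair z []) x ∧ C U x = z.length := by
  obtain ⟨f, hf, sound, total⟩ := exists_partrec_program_of_length U
  refine ⟨f, hf, fun x p hp => ?_⟩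
  obtain ⟨z₀, hz₀, hC⟩ := hU.exists_shortest_program x []
  rw [C, hC, ENat.toNat_natCast] at hp
  obtain ⟨z, hz⟩ := Part.dom_iff_mem.1 (total x p z₀ hp hz₀)
  obtain ⟨hlength, hzx⟩ := sound x p z hz
  exact ⟨z, hz, hzx, by rw [C, hC, word_injective (hp.unique hlength)]⟩

theorem IsUniversal.exists_reversible_erasing (hU : IsUniversal U) :
    ∃ R : TM, R.Reversible ∧ ∀ x p : List Bool, U.Outputs (pair p x) (word (C U x).toNat) →
      ∃ z : List Bool, C U x = z.length ∧ R.OutputsClean (pair x p) (pair [] (pair p z)) := by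
  obtain ⟨unpair, unpair_partrec, mem_unpair⟩ := exists_partrec_unpair
  obtain ⟨eval, eval_partrec, mem_eval⟩ := exists_partrec_mem_iff_outputs U
  obtain ⟨compress, compress_partrec, mem_compress⟩ := hU.exists_partrec_shortest_program
  have pairing := primrec_pair.to_comp
  have erase : Partrec fun w => (unpair w).bind fun a =>
      (compress a).map fun z => pair [] (pair a.2 z) :=
    unpair_partrec.bind ((compress_partrec.comp .snd).map (pairing.comp (.const [])
      (pairing.comp (Computable.snd.comp (Computable.snd.comp .fst)) .snd)).to₂).to₂
  have restore : Partrec fun w => (unpair w).bind fun b => (unpair b.2).bind fun a =>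
      (eval (pair a.2 [])).map fun x => pair x a.1 :=
    unpair_partrec.bind ((unpair_partrec.comp (Computable.snd.comp .snd)).bind
      ((eval_partrec.comp (pairing.comp (Computable.snd.comp .snd) (.const []))).map
        (pairing.comp .snd (Computable.fst.comp (Computable.snd.comp .fst))).to₂).to₂).to₂
  obtain ⟨R, hR, outputsClean⟩ := exists_reversible_of_partrec erase restore
  refine ⟨R, hR, fun x p hp => ?_⟩
  obtain ⟨z, hz, hzx, hC⟩ := mem_compress x p hp
  refine ⟨z, hC, outputsClean _ _ ?_ ?_⟩
  · exact Part.mem_bind (mem_unpair x p) (Part.mem_map _ hz)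
  · exact Part.mem_bind (mem_unpair [] (pair p z)) (Part.mem_bind (mem_unpair p z)
      (Part.mem_map (fun x => pair x p) ((mem_eval _ _).2 hzx)))

variable {UR : TM}

theorem IsUniversal.exists_E_le (hU : IsUniversal U) (hUR : IsUniversalReversible UR) :
    ∃ c : ℕ, ∀ x : List Bool,
      E UR x [] ≤ C U x + c * (condC U (word (C U x).toNat) x + 1) := by
  obtain ⟨R, hR, erasing⟩ := hU.exists_reversible_erasing
  obtain ⟨c, hc⟩ := hUR.2 R hR
  refine ⟨c + 3, fun x => ?_⟩
  obtain ⟨p, hp, hpC⟩ := hU.exists_shortest_program (word (C U x).toNat) x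
  obtain ⟨z, hz, hxz⟩ := erasing x p hp
  calc E UR x [] ≤ E R x [] + c := hc x []
    _ ≤ (p.length + (pair p z).length : ℕ) + c := by gcongr; exact E_le hxz
    _ ≤ z.length + (c + 3 : ℕ) * (p.length + 1) := by
      rw [length_pair]
      norm_cast
      nlinarith [Nat.zero_le (c * p.length)]
    _ = C U x + (c + 3 : ℕ) * (condC U (word (C U x).toNat) x + 1) := by rw [hpC, hz]

theorem IsUniversal.exists_E_le_log (hU : IsUniversal U) (hUR : IsUniversalReversible UR) :
    ∃ c : ℕ, ∀ x : List Bool,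
      E UR x [] ≤ C U x + ((c * (Nat.log 2 (C U x).toNat + 1) : ℕ) : ℕ∞) := by
  obtain ⟨c, hc⟩ := hU.exists_E_le hUR
  obtain ⟨d, hd⟩ := hU.exists_condC_le_length
  refine ⟨c * (d + 2), fun x => (hc x).trans (add_le_add_right ?_ _)⟩
  set n := (C U x).toNat
  calc (c : ℕ∞) * (condC U (word n) x + 1)
      ≤ c * (((Nat.log 2 n + 1 + d : ℕ) : ℕ∞) + 1) := by
        gcongr
        exact (hd (word n) x).trans (by gcongr; exact length_word_le n)
    _ ≤ ((c * (d + 2) * (Nat.log 2 n + 1) : ℕ) : ℕ∞) := by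
      norm_cast
      rw [mul_assoc]
      gcongr
      nlinarith [Nat.zero_le (d * Nat.log 2 n)]

end IrreversibilityCost

end RevComp

theorem mainTheorem9 (U UR : RevComp.TM) (hU : RevComp.IsUniversal U)
    (hUR : RevComp.IsUniversalReversible UR) :
    (∀ x : List Bool, RevComp.C U x < ⊤ ∧
      ∀ t : ℕ → ℕ → ℕ, Tendsto (fun n => t n x.length) atTop atTop →
        Tendsto (fun n => RevComp.Ct U (t n) x) atTop (𝓝 (RevComp.C U x))) ∧
    (∃ c : ℕ, ∀ x : List Bool, RevComp.C U x ≤ RevComp.E UR x [] + c) ∧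
    (∃ c : ℕ, ∀ x : List Bool,
      RevComp.E UR x [] ≤
        RevComp.C U x + c * (RevComp.condC U (RevComp.word (RevComp.C U x).toNat) x + 1)) ∧
    (∃ c : ℕ, ∀ x : List Bool,
      RevComp.E UR x [] ≤
        RevComp.C U x + ((c * (Nat.log 2 (RevComp.C U x).toNat + 1) : ℕ) : ℕ∞)) :=
  ⟨fun x => ⟨hU.condC_lt_top x [], fun _ ht => hU.tendsto_Ct x ht⟩, hU.exists_C_le_E hUR.1,
    hU.exists_E_le hUR, hU.exists_E_le_log hUR⟩
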